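/- Let $N\ge 1$, $T>0$, and let $A\in\mathbb{R}^{N\times N}$, $B\in\mathbb{R}^N$ be given by $A_{ij}=\sqrt{(2i-1)(2j-1)}$ for $i>j$, $A_{ii}=i$, $A_{ij}=0$ for $i<j$, and $B_j=\sqrt{2j-1}$ ($1\le i,j\le N$). Let $e_1$ be the first standard basis vector of $\mathbb{R}^N$ and let $f:[0,T]\to\mathbb{R}$ be Riemann integrable. Consider the LegS initial value problem $$c'(t)=-\tfrac1t A\,c(t)+\tfrac1t B f(t),\qquad c(0)=f(0)e_1 .$$ A function $c:[0,T]\to\mathbb{R}^N$ is called a solution if $c(0)=f(0)e_1$, $c$ is bounded on $[0,T]$, $c$ is absolutely continuous on $[\varepsilon,T]$ for every $\varepsilon\in(0,T)$, and $c$ satisfies the differential equation for almost every $t\in(0,T]$. (A function with the other properties that is continuous on $[0,T]$ is bounded, hence is a solution.) Then there is exactly one solution $c$ on $[0,T]$, and each of the following five discretizations converges to it. For $n\ge1$ put $h=T/n$, $t_k=kh$, $f^k=f(t_k)$, $c^0=f(0)e_1$, and for $k=0,1,\dots,n-1$ define $c^{k+1}$ by one of: 1. Forward Euler: $c^1=c^0$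 and, for $k\ge1$, $c^{k+1}=(I-\frac1kA)c^k+\frac1kBf^k$. 2. Backward Euler: $c^{k+1}=(I+\frac1{k+1}A)^{-1}\big(c^k+\frac1{k+1}Bf^{k+1}\big)$. 3. Bilinear with zero-out: $c^1=(I+\frac12A)^{-1}\big(c^0+\frac12Bf^1\big)$ and, for $k\ge1$, $c^{k+1}=(I+\frac1{2(k+1)}A)^{-1}\Big((I-\frac1{2k}A)c^k+\big(\frac1{2k}f^k+\frac1{2(k+1)}f^{k+1}\big)B\Big)$. 4. Approximate bilinear: $c^{k+1}=(I+\frac1{2(k+1)}A)^{-1}\Big((I-\frac1{2(k+1)}A)c^k+\frac1{k+1}Bf^{k+1}\Big)$. 5. Zero-order hold: $c^{k+1}=E_kc^k+A^{-1}(I-E_k)Bf^k$, where $E_0=0$ and $E_k=\exp\!\big(\log(\tfrac{k}{k+1})A\big)$ for $k\ge1$. For each of the five methods, $\|c^n-c(t_n)\|\to0$ as $n\to\infty$, where $c^n$ is the last iterate computed with step size $h=T/n$, $t_n=nh=T$, and $\|\cdot\|$ is the Euclidean norm. -/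

import Mathlib

open Filter Topology MeasureTheory Set
open scoped Matrix

noncomputable section

/-- `f` is Riemann integrable on `[a, b]`: the Riemann sums over tagged partitions of `[a, b]`
converge as the mesh tends to zero (Mathlib's box integral in dimension one). -/
def RiemannIntegrableOn (f : ℝ → ℝ) (a b : ℝ) (hab : a < b) : Prop :=
  BoxIntegral.Integrable
    (BoxIntegral.Box.mk (fun _ : Fin 1 => a) (fun _ => b) (fun _ => hab))
    BoxIntegral.IntegrationParams.Riemann (fun x : Fin 1 → ℝ => f (x 0))
    (BoxIntegral.BoxAdditiveMap.volume (E := ℝ))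

/-- The lower triangular matrix `A`; the index `i : Fin N` stands for the 1-based index `i + 1`,
so that `√(2i - 1)` becomes `√(2i + 1)` and the diagonal entries are `1, …, N`. -/
def legSA (N : ℕ) : Matrix (Fin N) (Fin N) ℝ :=
  Matrix.of fun i j =>
    if j < i then Real.sqrt (2 * (i : ℝ) + 1) * Real.sqrt (2 * (j : ℝ) + 1)
    else if i = j then (i : ℝ) + 1
    else 0

/-- The vector `B`, with entries `√(2j - 1)` in 1-based indexing. -/
def legSB (N : ℕ) : Fin N → ℝ := fun j => Real.sqrt (2 * (j : ℝ) + 1)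

/-- The first standard basis vector of `ℝ^N`. -/
def legSe1 (N : ℕ) : Fin N → ℝ := fun i => if (i : ℕ) = 0 then 1 else 0

/-- `c` is the exact solution on `[0, T]` of the LegS initial value problem
`c'(t) = -(1/t) A c(t) + (1/t) B f(t)`, `c(0) = f(0) e₁`: it is locally absolutely continuous on
`(0, T]`, satisfies the equation almost everywhere, takes the initial value, and is bounded.
Boundedness is what selects the solution at the singularity; every solution that is continuous on
the whole of `[0, T]` is bounded, see `IsLegSSolution.of_continuousOn`. Continuity at `0` itself
is not asked for, since it fails when `f` has no Lebesgue point at `0`. -/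
structure IsLegSSolution (N : ℕ) (T : ℝ) (f : ℝ → ℝ) (c : ℝ → Fin N → ℝ) : Prop where
  initial : c 0 = f 0 • legSe1 N
  bounded : ∃ M : ℝ, ∀ t ∈ Icc 0 T, ‖c t‖ ≤ M
  absCont : ∀ ε ∈ Ioo 0 T, AbsolutelyContinuousOnInterval c ε T
  ode : ∀ᵐ t ∂(volume.restrict (Ioc 0 T)),
    HasDerivAt c (-((1 / t) • (legSA N *ᵥ c t)) + (1 / t) • (f t • legSB N)) t

/-- Solutions in the sense that is usual when `f` has a Lebesgue point at `0`, that is, with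
continuity on `[0, T]` in place of boundedness, are solutions. -/
theorem IsLegSSolution.of_continuousOn {N : ℕ} {T : ℝ} {f : ℝ → ℝ} {c : ℝ → Fin N → ℝ}
    (h0 : c 0 = f 0 • legSe1 N) (hc : ContinuousOn c (Icc 0 T))
    (hac : ∀ ε ∈ Ioo 0 T, AbsolutelyContinuousOnInterval c ε T)
    (hode : ∀ᵐ t ∂(volume.restrict (Ioc 0 T)),
      HasDerivAt c (-((1 / t) • (legSA N *ᵥ c t)) + (1 / t) • (f t • legSB N)) t) :
    IsLegSSolution N T f c :=
  ⟨h0, isCompact_Icc.exists_bound_of_continuousOn hc, hac, hode⟩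

/-- The five discretization methods. -/
inductive LegSScheme where
  | forwardEuler
  | backwardEuler
  | bilinear
  | approxBilinear
  | zeroOrderHold

/-- The matrix `exp (A log (k / (k + 1)))`, with value `0` at `k = 0`. -/
def legSExp (N k : ℕ) : Matrix (Fin N) (Fin N) ℝ :=
  if k = 0 then 0 else NormedSpace.exp (Real.log ((k : ℝ) / ((k : ℝ) + 1)) • legSA N)

/-- The step `c^k ↦ c^{k+1}` of each method, where `u = f^k` and `v = f^{k+1}` are the samples of
the input. The terms with a factor `1 / k` are set to `0` at `k = 0`. -/
def legSStep (N : ℕ) (s : LegSScheme) (k : ℕ) (u v : ℝ) (c : Fin N → ℝ) : Fin N → ℝ :=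
  match s with
  | .forwardEuler =>
      if k = 0 then c
      else (1 - (1 / (k : ℝ)) • legSA N) *ᵥ c + ((1 / (k : ℝ)) * u) • legSB N
  | .backwardEuler =>
      (1 + (1 / ((k : ℝ) + 1)) • legSA N)⁻¹ *ᵥ c
        + (1 + (1 / ((k : ℝ) + 1)) • legSA N)⁻¹ *ᵥ (((1 / ((k : ℝ) + 1)) * v) • legSB N)
  | .bilinear =>
      if k = 0 then
        (1 + (1 / 2 : ℝ) • legSA N)⁻¹ *ᵥ c
          + (1 / 2 : ℝ) • ((1 + (1 / 2 : ℝ) • legSA N)⁻¹ *ᵥ (v • legSB N))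
      else
        (1 + (1 / (2 * ((k : ℝ) + 1))) • legSA N)⁻¹ *ᵥ
            ((1 - (1 / (2 * (k : ℝ))) • legSA N) *ᵥ c)
          + (1 + (1 / (2 * ((k : ℝ) + 1))) • legSA N)⁻¹ *ᵥ
            (((1 / (2 * (k : ℝ))) * u + (1 / (2 * ((k : ℝ) + 1))) * v) • legSB N)
  | .approxBilinear =>
      (1 + (1 / (2 * ((k : ℝ) + 1))) • legSA N)⁻¹ *ᵥ
          ((1 - (1 / (2 * ((k : ℝ) + 1))) • legSA N) *ᵥ c)
        + (1 + (1 / (2 * ((k : ℝ) + 1))) • legSA N)⁻¹ *ᵥ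
          (((1 / ((k : ℝ) + 1)) * v) • legSB N)
  | .zeroOrderHold =>
      legSExp N k *ᵥ c + (legSA N)⁻¹ *ᵥ ((1 - legSExp N k) *ᵥ (u • legSB N))

/-- The numerical solution `c^k` with step size `h` and `c^0 = f(0) e₁`. -/
def legSIterate (N : ℕ) (s : LegSScheme) (h : ℝ) (f : ℝ → ℝ) : ℕ → Fin N → ℝ
  | 0 => f 0 • legSe1 N
  | k + 1 => legSStep N s k (f ((k : ℝ) * h)) (f (((k : ℝ) + 1) * h)) (legSIterate N s h f k)

end

/-!
The matrix `A` is lower triangular with the distinct diagonal entries `1, …, N`, so it has a basis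
of left eigenvectors, the rows of an invertible matrix `Q` with `Q A = diag(1, …, N) Q`
(`exists_isUnit_mul_legSA`). In the coordinates `Q c` both the differential equation and all five
methods, being built from rational functions of `A` and from `exp (a A)`, decouple into scalar
problems, one for each eigenvalue `m + 1` (`mulVec_legSStep`).

For the scalar equation `y' = -((m+1)/t) y + (b/t) f` the function `t^{m+1} y(t) - b ∫₀ᵗ sᵐ f(s) ds`
is locally absolutely continuous with derivative zero almost everywhere, hence constant, and the
constant is zero for bounded `y` (`pow_mul_eq_moment_of_hasDerivAt`). This gives uniqueness, and
the resulting formula gives existence.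

For convergence, let `e_k` be the error after `k` steps. Every method multiplies by
`1 - (m+1)/(k+1) + O((k+1)⁻²)` and gives the samples of `f` the total weight
`1/(k+1) + O((k+1)⁻²)`, and so does the exact solution, with the mean of `f` over the cell in place
of a sample. With `ω_k` the oscillation of `f` on `[t_k, t_{k+1}]` this yields
`e_{k+1} ≤ (1 - 1/(k+1) + C/(k+1)²) e_k + D/(k+1)² + D ω_k/(k+1)` (`abs_error_step_le`).
Such `e_k` are bounded, and multiplying by `k + 1` and summing gives
`n e_n ≤ C' ∑_{k<n} 1/(k+1) + D ∑_{k<n} ω_k` (`tendsto_zero_of_recursive_bound`). The right-hand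
side is `o(n)`, because the mean oscillation of a Riemann integrable function over the cells of a
uniform grid tends to zero (`RiemannIntegrableOn.exists_sum_oscillation_le`). The initial value
enters only through the bound for the `e_k`, so it plays no role in the limit.
-/

/-! ### Riemann sums over uniform grids -/

/-- The `k`-th cell `(kh, (k+1)h]` of the uniform grid of width `h`, as a one-dimensional box. -/
def gridBox (h : ℝ) (hh : 0 < h) (k : ℕ) : BoxIntegral.Box (Fin 1) where
  lower := fun _ => k * h
  upper := fun _ => (k + 1) * h
  lower_lt_upper := fun _ => by nlinarith

lemma gridBox_injective (h : ℝ) (hh : 0 < h) : Function.Injective (gridBox h hh) := by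
  intro i j hij
  have h1 : (i : ℝ) * h = j * h := congrFun (congrArg BoxIntegral.Box.lower hij) 0
  exact_mod_cast mul_right_cancel₀ hh.ne' h1

/-- The interval `[0, T]`, where `T = nh`, cut into the `n` cells of the uniform grid of width `h`,
with the tag `ξ k` in the `k`-th cell. -/
noncomputable def gridPartition (T h : ℝ) (hT : 0 < T) (hh : 0 < h) (n : ℕ) (hn : n * h = T) (ξ : Fin n → ℝ)
    (hξ : ∀ k : Fin n, ξ k ∈ Icc (k * h) ((k + 1) * h)) :
    BoxIntegral.TaggedPrepartition
      (BoxIntegral.Box.mk (fun _ : Fin 1 => 0) (fun _ => T) (fun _ => hT)) where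
  boxes := Finset.univ.map
    ⟨fun k : Fin n => gridBox h hh k, (gridBox_injective h hh).comp Fin.val_injective⟩
  le_of_mem' := by
    intro J hJ
    obtain ⟨k, -, rfl⟩ := Finset.mem_map.1 hJ
    rw [BoxIntegral.Box.le_iff_bounds]
    have hk : ((k : ℕ) : ℝ) + 1 ≤ n := by exact_mod_cast k.2
    refine ⟨fun _ => ?_, fun _ => ?_⟩
    · show (0 : ℝ) ≤ k * h
      positivity
    · show ((k : ℕ) + 1) * h ≤ T
      rw [← hn]
      gcongr
  pairwiseDisjoint := by
    intro J hJ J' hJ' hne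
    obtain ⟨k, -, rfl⟩ := Finset.mem_map.1 hJ
    obtain ⟨k', -, rfl⟩ := Finset.mem_map.1 hJ'
    refine Set.disjoint_left.2 fun x hx hx' => hne ?_
    have h1 : (k : ℝ) * h < x 0 ∧ x 0 ≤ (k + 1) * h := hx 0
    have h2 : (k' : ℝ) * h < x 0 ∧ x 0 ≤ (k' + 1) * h := hx' 0
    have h3 : (k : ℝ) < k' + 1 := lt_of_mul_lt_mul_right (h1.1.trans_le h2.2) hh.le
    have h4 : (k' : ℝ) < k + 1 := lt_of_mul_lt_mul_right (h2.1.trans_le h1.2) hh.le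
    have h5 : (k : ℕ) < k' + 1 := by exact_mod_cast h3
    have h6 : (k' : ℕ) < k + 1 := by exact_mod_cast h4
    have : k = k' := Fin.ext (by omega)
    rw [this]
  tag := Function.extend (gridBox h hh ∘ Fin.val) (fun k _ => ξ k) (fun _ _ => 0)
  tag_mem_Icc := by
    intro J
    rw [BoxIntegral.Box.Icc_def]
    by_cases hJ : ∃ k : Fin n, (gridBox h hh ∘ Fin.val) k = J
    · obtain ⟨k, rfl⟩ := hJ
      rw [((gridBox_injective h hh).comp Fin.val_injective).extend_apply]
      have hk : ((k : ℕ) : ℝ) + 1 ≤ n := by exact_mod_cast k.2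
      refine ⟨fun _ => ?_, fun _ => ?_⟩
      · exact le_trans (by positivity) (hξ k).1
      · refine (hξ k).2.trans ?_
        show _ ≤ T
        rw [← hn]
        gcongr
    · rw [Function.extend_apply' _ _ _ hJ]
      exact ⟨fun _ => le_rfl, fun _ => hT.le⟩

lemma gridPartition_tag (T h : ℝ) (hT : 0 < T) (hh : 0 < h) (n : ℕ) (hn : n * h = T)
    (ξ : Fin n → ℝ) (hξ : ∀ k : Fin n, ξ k ∈ Icc (k * h) ((k + 1) * h)) (k : Fin n) :
    (gridPartition T h hT hh n hn ξ hξ).tag (gridBox h hh k) = fun _ => ξ k :=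
  ((gridBox_injective h hh).comp Fin.val_injective).extend_apply
    (fun k _ => ξ k) (fun _ _ => 0) k

lemma gridPartition_isPartition (T h : ℝ) (hT : 0 < T) (hh : 0 < h) (n : ℕ) (hn : n * h = T)
    (ξ : Fin n → ℝ) (hξ : ∀ k : Fin n, ξ k ∈ Icc (k * h) ((k + 1) * h)) :
    (gridPartition T h hT hh n hn ξ hξ).IsPartition := by
  intro x hx
  have hx0 : 0 < x 0 ∧ x 0 ≤ T := hx 0
  have hpos : 0 < x 0 / h := div_pos hx0.1 hh
  have hc : 0 < ⌈x 0 / h⌉₊ := Nat.ceil_pos.2 hpos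
  have hcn : ⌈x 0 / h⌉₊ ≤ n := Nat.ceil_le.2 (by rw [div_le_iff₀ hh, hn]; exact hx0.2)
  refine ⟨gridBox h hh (⌈x 0 / h⌉₊ - 1),
    Finset.mem_map.2 ⟨⟨⌈x 0 / h⌉₊ - 1, by omega⟩, Finset.mem_univ _, rfl⟩, fun i => ?_⟩
  rw [Subsingleton.elim i 0]
  have h1 : ((⌈x 0 / h⌉₊ - 1 : ℕ) : ℝ) = ⌈x 0 / h⌉₊ - 1 := by
    rw [Nat.cast_sub hc]; simp
  show ((⌈x 0 / h⌉₊ - 1 : ℕ) : ℝ) * h < x 0 ∧ x 0 ≤ (((⌈x 0 / h⌉₊ - 1 : ℕ) : ℝ) + 1) * h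
  rw [h1, ← lt_div_iff₀ hh, ← div_le_iff₀ hh]
  have := Nat.ceil_lt_add_one hpos.le
  have := Nat.le_ceil (x 0 / h)
  exact ⟨by linarith, by linarith⟩

/-- The Riemann sums of a Riemann integrable function over a fine uniform grid depend little on the
tags. -/
lemma RiemannIntegrableOn.abs_sum_sub_le {T : ℝ} {hT : 0 < T} {f : ℝ → ℝ}
    (hf : RiemannIntegrableOn f 0 T hT) {ε : ℝ} (hε : 0 < ε) :
    ∃ n₀ : ℕ, 0 < n₀ ∧ ∀ n ≥ n₀, ∀ ξ η : ℕ → ℝ,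
      (∀ k < n, ξ k ∈ Icc (k * (T / n)) ((k + 1) * (T / n))) →
      (∀ k < n, η k ∈ Icc (k * (T / n)) ((k + 1) * (T / n))) →
      |∑ k ∈ Finset.range n, T / n * (f (ξ k) - f (η k))| ≤ ε := by
  obtain ⟨r, hr, H⟩ := BoxIntegral.integrable_iff_cauchy_basis.1 hf ε hε
  obtain ⟨n₀, hn₀⟩ := exists_nat_gt (T / (r 0 0 : ℝ))
  refine ⟨n₀ + 1, by omega, fun n hn ξ η hξ hη => ?_⟩
  have hn' : 0 < n := by omega
  have hnR : (0 : ℝ) < n := by exact_mod_cast hn'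
  have hh : 0 < T / n := div_pos hT hnR
  have hnh : n * (T / n) = T := by field_simp
  have hr0 : (0 : ℝ) < r 0 0 := (r 0 0).2
  have hmesh : T / n ≤ (r 0 0 : ℝ) := by
    rw [div_lt_iff₀ hr0] at hn₀
    rw [div_le_iff₀ hnR]
    have : (n₀ : ℝ) + 1 ≤ n := by exact_mod_cast hn
    nlinarith
  have key : ∀ (ζ : Fin n → ℝ) (hζ : ∀ k : Fin n, ζ k ∈ Icc (k * (T / n)) ((k + 1) * (T / n))),
      BoxIntegral.IntegrationParams.Riemann.MemBaseSet _ 0 (r 0)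
        (gridPartition T (T / n) hT hh n hnh ζ hζ) := by
    intro ζ hζ
    refine ⟨?_, fun _ => ?_, fun hd => ?_, fun hd => ?_⟩
    · intro J hJ
      obtain ⟨k, -, rfl⟩ := Finset.mem_map.1 hJ
      intro x hx
      have hx0 : (k : ℝ) * (T / n) ≤ x 0 ∧ x 0 ≤ (k + 1) * (T / n) := ⟨hx.1 0, hx.2 0⟩
      rw [Metric.mem_closedBall, hr 0 rfl, dist_pi_le_iff hr0.le]
      intro i
      rw [Subsingleton.elim i 0]
      refine le_trans ?_ hmesh
      have ht := congrFun (gridPartition_tag T (T / n) hT hh n hnh ζ hζ k) 0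
      change dist (x 0) ((gridPartition T (T / n) hT hh n hnh ζ hζ).tag (gridBox (T / n) hh k) 0) ≤ _
      rw [ht, Real.dist_eq, abs_le]
      have := hζ k
      constructor <;> linarith [this.1, this.2]
    · intro J hJ
      obtain ⟨k, -, rfl⟩ := Finset.mem_map.1 hJ
      change (gridPartition T (T / n) hT hh n hnh ζ hζ).tag (gridBox (T / n) hh k) ∈ _
      rw [gridPartition_tag, BoxIntegral.Box.Icc_def]
      exact ⟨fun _ => (hζ k).1, fun _ => (hζ k).2⟩
    · exact absurd hd (by decide)
    · exact absurd hd (by decide)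
  have hsum : ∀ (ζ : Fin n → ℝ)
      (hζ : ∀ k : Fin n, ζ k ∈ Icc (k * (T / n)) ((k + 1) * (T / n))),
      BoxIntegral.integralSum (fun x : Fin 1 → ℝ => f (x 0))
        (BoxIntegral.BoxAdditiveMap.volume (E := ℝ)) (gridPartition T (T / n) hT hh n hnh ζ hζ)
        = ∑ k : Fin n, T / n * f (ζ k) := by
    intro ζ hζ
    rw [BoxIntegral.integralSum]
    change ∑ J ∈ Finset.map _ _, _ = _
    rw [Finset.sum_map]
    refine Finset.sum_congr rfl fun k _ => ?_
    change BoxIntegral.BoxAdditiveMap.volume (gridBox (T / n) hh k)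
      (f ((gridPartition T (T / n) hT hh n hnh ζ hζ).tag (gridBox (T / n) hh k) 0)) = _
    rw [gridPartition_tag, BoxIntegral.BoxAdditiveMap.volume_apply]
    simp only [gridBox, Finset.univ_unique, Finset.prod_singleton, smul_eq_mul]
    ring
  have := H 0 0 _ _ (key (fun k => ξ k) fun k => hξ k k.2)
    (gridPartition_isPartition _ _ _ _ _ _ _ _) (key (fun k => η k) fun k => hη k k.2)
    (gridPartition_isPartition _ _ _ _ _ _ _ _)
  rw [hsum, hsum, Real.dist_eq, ← Finset.sum_sub_distrib] at this
  rw [Finset.sum_range]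
  simpa only [mul_sub] using this

/-! ### Boundedness, oscillation and measurability of Riemann integrable functions -/

lemma exists_mem_grid_cell {T t : ℝ} {n : ℕ} (hn : 0 < n) (hT : 0 < T) (ht : t ∈ Icc 0 T) :
    ∃ k < n, t ∈ Icc (k * (T / n)) ((k + 1) * (T / n)) := by
  have hnR : (0 : ℝ) < n := by exact_mod_cast hn
  have hh : 0 < T / n := div_pos hT hnR
  rcases ht.1.eq_or_lt with h0 | h0
  · exact ⟨0, hn, by rw [← h0]; constructor <;> simp; positivity⟩
  have hpos : 0 < t / (T / n) := div_pos h0 hh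
  have hc : 0 < ⌈t / (T / n)⌉₊ := Nat.ceil_pos.2 hpos
  have hcn : ⌈t / (T / n)⌉₊ ≤ n :=
    Nat.ceil_le.2 (by rw [div_le_iff₀ hh, mul_div_cancel₀ _ hnR.ne']; exact ht.2)
  refine ⟨⌈t / (T / n)⌉₊ - 1, by omega, ?_⟩
  rw [mem_Icc, Nat.cast_sub hc, ← le_div_iff₀ hh, ← div_le_iff₀ hh]
  have := Nat.ceil_lt_add_one hpos.le
  have := Nat.le_ceil (t / (T / n))
  push_cast
  exact ⟨by linarith, by linarith⟩

/-- Moving a single tag changes a Riemann sum by at most a fixed amount, so the function is bounded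
on each cell of a fine grid. -/
lemma RiemannIntegrableOn.exists_bound {T : ℝ} {hT : 0 < T} {f : ℝ → ℝ}
    (hf : RiemannIntegrableOn f 0 T hT) : ∃ M : ℝ, 0 ≤ M ∧ ∀ t ∈ Icc 0 T, |f t| ≤ M := by
  obtain ⟨n, hn, H⟩ := hf.abs_sum_sub_le one_pos
  have hnR : (0 : ℝ) < n := by exact_mod_cast hn
  have hh : 0 < T / n := div_pos hT hnR
  refine ⟨(T / n)⁻¹ + ∑ j ∈ Finset.range n, |f (j * (T / n))|, by positivity, fun t ht => ?_⟩
  obtain ⟨k, hk, htk⟩ := exists_mem_grid_cell hn hT ht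
  have hleft : ∀ j < n, (j : ℝ) * (T / n) ∈ Icc (j * (T / n)) ((j + 1) * (T / n)) := fun j _ =>
    ⟨le_rfl, by nlinarith⟩
  have h1 := H n le_rfl (fun j => if j = k then t else j * (T / n)) (fun j => j * (T / n))
    (fun j hj => by
      by_cases h : j = k
      · subst h; simpa using htk
      · simpa [h] using hleft j hj) hleft
  have h2 : ∑ j ∈ Finset.range n, T / n *
      (f (if j = k then t else j * (T / n)) - f (j * (T / n)))
        = T / n * (f t - f (k * (T / n))) := by
    rw [Finset.sum_eq_single_of_mem k (Finset.mem_range.2 hk)]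
    · simp
    · intro j _ hj
      simp [hj]
  rw [h2, abs_mul, abs_of_pos hh, ← le_div_iff₀' hh, one_div] at h1
  have h3 : |f (k * (T / n))| ≤ ∑ j ∈ Finset.range n, |f (j * (T / n))| :=
    Finset.single_le_sum (f := fun j : ℕ => |f (j * (T / n))|) (fun _ _ => abs_nonneg _)
      (Finset.mem_range.2 hk)
  have h4 := abs_sub_abs_le_abs_sub (f t) (f (k * (T / n)))
  linarith

/-- Darboux's criterion on uniform grids: the mean of the oscillations over the cells tends to
zero. -/
lemma RiemannIntegrableOn.exists_sum_oscillation_le {T : ℝ} {hT : 0 < T} {f : ℝ → ℝ}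
    (hf : RiemannIntegrableOn f 0 T hT) {ε : ℝ} (hε : 0 < ε) :
    ∃ n₀ : ℕ, 0 < n₀ ∧ ∀ n ≥ n₀, ∃ ω : ℕ → ℝ,
      (∀ k < n, ∀ x ∈ Icc (k * (T / n)) ((k + 1) * (T / n)),
        ∀ y ∈ Icc (k * (T / n)) ((k + 1) * (T / n)), |f x - f y| ≤ ω k) ∧
      ∑ k ∈ Finset.range n, ω k ≤ ε * n := by
  obtain ⟨M, -, hM⟩ := hf.exists_bound
  -- half of `ε` for the Riemann sums, half for the suprema that need not be attained
  obtain ⟨n₀, hn₀, H⟩ := hf.abs_sum_sub_le (ε := ε / 2 * T) (by positivity)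
  refine ⟨n₀, hn₀, fun n hn => ?_⟩
  have hn' : 0 < n := by omega
  have hnR : (0 : ℝ) < n := by exact_mod_cast hn'
  have hh : 0 < T / n := div_pos hT hnR
  have hsub : ∀ k < n, Icc ((k : ℝ) * (T / n)) ((k + 1) * (T / n)) ⊆ Icc 0 T := by
    intro k hk
    have hkn : (k : ℝ) + 1 ≤ n := by exact_mod_cast hk
    refine Icc_subset_Icc (by positivity) ?_
    calc (k + 1) * (T / n) ≤ n * (T / n) := by gcongr
      _ = T := by field_simp
  -- tags between which the oscillation on a cell is attained up to `ε / 2`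
  have hext : ∀ k : ℕ, ∃ p : ℝ × ℝ, k < n →
      p.1 ∈ Icc ((k : ℝ) * (T / n)) ((k + 1) * (T / n)) ∧
      p.2 ∈ Icc ((k : ℝ) * (T / n)) ((k + 1) * (T / n)) ∧
      ∀ x ∈ Icc ((k : ℝ) * (T / n)) ((k + 1) * (T / n)),
        ∀ y ∈ Icc ((k : ℝ) * (T / n)) ((k + 1) * (T / n)),
          f x - f y ≤ f p.1 - f p.2 + ε / 2 := by
    intro k
    by_cases hk : k < n
    swap
    · exact ⟨0, fun h => absurd h hk⟩
    set I := Icc ((k : ℝ) * (T / n)) ((k + 1) * (T / n)) with hI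
    have hmem : (k : ℝ) * (T / n) ∈ I := ⟨le_rfl, by nlinarith⟩
    set S := Set.image2 (fun x y => f x - f y) I I with hS
    have hne : S.Nonempty := ⟨_, _, hmem, _, hmem, rfl⟩
    have hbdd : BddAbove S := by
      refine ⟨2 * M, ?_⟩
      rintro _ ⟨x, hx, y, hy, rfl⟩
      have h1 := abs_le.1 (hM x (hsub k hk hx))
      have h2 := abs_le.1 (hM y (hsub k hk hy))
      show f x - f y ≤ 2 * M
      linarith [h1.2, h2.1]
    obtain ⟨_, ⟨ξ, hξ, η, hη, rfl⟩, hlt⟩ :=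
      exists_lt_of_lt_csSup hne (show sSup S - ε / 2 < sSup S by linarith)
    refine ⟨(ξ, η), fun _ => ⟨hξ, hη, fun x hx y hy => ?_⟩⟩
    have := le_csSup hbdd (show f x - f y ∈ S from ⟨x, hx, y, hy, rfl⟩)
    simp only at hlt ⊢
    linarith
  choose p hp using hext
  refine ⟨fun k => f (p k).1 - f (p k).2 + ε / 2, fun k hk x hx y hy => ?_, ?_⟩
  · have h1 := (hp k hk).2.2 x hx y hy
    have h2 := (hp k hk).2.2 y hy x hx
    exact abs_le.2 ⟨by linarith, h1⟩
  · have h1 := (le_abs_self _).trans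
      (H n hn (fun k => (p k).1) (fun k => (p k).2) (fun k hk => (hp k hk).1)
        (fun k hk => (hp k hk).2.1))
    rw [← Finset.mul_sum, div_mul_eq_mul_div, div_le_iff₀ hnR] at h1
    have h2 : ∑ k ∈ Finset.range n, (f (p k).1 - f (p k).2) ≤ ε / 2 * n :=
      le_of_mul_le_mul_left (by linarith) hT
    rw [Finset.sum_add_distrib, Finset.sum_const, Finset.card_range, nsmul_eq_mul]
    linarith

/-- A Riemann integrable function is the almost everywhere limit of step functions: the left-point
step functions differ from `f` by at most the oscillation step functions, which tend to zero in
`L¹`, hence almost everywhere along a subsequence. -/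
lemma RiemannIntegrableOn.aestronglyMeasurable {T : ℝ} {hT : 0 < T} {f : ℝ → ℝ}
    (hf : RiemannIntegrableOn f 0 T hT) :
    AEStronglyMeasurable f (volume.restrict (Ico 0 T)) := by
  have hε : ∀ j : ℕ, (0 : ℝ) < 1 / (j + 1) := fun j => by positivity
  choose N hN0 hN using fun j : ℕ => hf.exists_sum_oscillation_le (hε j)
  choose ω hω hsum using fun j : ℕ => hN j (N j) le_rfl
  have hNR : ∀ j, (0 : ℝ) < N j := fun j => by exact_mod_cast hN0 j
  have hh : ∀ j, 0 < T / N j := fun j => div_pos hT (hNR j)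
  set cell : ℕ → ℝ → ℕ := fun j t => ⌊t / (T / N j)⌋₊ with hcell
  have hcm : ∀ j, Measurable (cell j) := fun j => Nat.measurable_floor.comp (by fun_prop)
  set W : ℕ → ℝ → ℝ := fun j t => ω j (cell j t) with hW
  set g : ℕ → ℝ → ℝ := fun j t => f (cell j t * (T / N j)) with hg
  have hWm : ∀ j, Measurable (W j) := fun j => (measurable_from_nat (f := ω j)).comp (hcm j)
  have hgm : ∀ j, Measurable (g j) := fun j =>
    (measurable_from_nat (f := fun k : ℕ => f (k * (T / N j)))).comp (hcm j)
  have hlt : ∀ j, ∀ t ∈ Ico 0 T, cell j t < N j := by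
    intro j t ht
    rw [hcell, Nat.floor_lt (div_nonneg ht.1 (hh j).le), div_lt_iff₀ (hh j),
      mul_div_cancel₀ _ (hNR j).ne']
    exact ht.2
  have hmem : ∀ j, ∀ t ∈ Ico 0 T,
      t ∈ Ico (cell j t * (T / N j)) ((cell j t + 1) * (T / N j)) := by
    intro j t ht
    rw [mem_Ico, ← le_div_iff₀ (hh j), ← div_lt_iff₀ (hh j)]
    exact ⟨Nat.floor_le (div_nonneg ht.1 (hh j).le), Nat.lt_floor_add_one _⟩
  have hleft : ∀ (j k : ℕ), (k : ℝ) * (T / N j) ∈ Icc (k * (T / N j)) ((k + 1) * (T / N j)) :=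
    fun j k => ⟨le_rfl, by nlinarith [hh j]⟩
  have hω0 : ∀ j, ∀ k < N j, 0 ≤ ω j k := fun j k hk =>
    (abs_nonneg _).trans (hω j k hk _ (hleft j k) _ (hleft j k))
  have hclose : ∀ j, ∀ t ∈ Ico 0 T, |g j t - f t| ≤ W j t := fun j t ht =>
    hω j _ (hlt j t ht) _ (hleft j _) _ (Ico_subset_Icc_self (hmem j t ht))
  have hint : ∀ j, eLpNorm (W j - 0) 1 (volume.restrict (Ico 0 T))
      ≤ ENNReal.ofReal (T * (1 / (j + 1))) := by
    intro j
    rw [sub_zero, eLpNorm_one_eq_lintegral_enorm]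
    have hcover : Ico 0 T ⊆ ⋃ k : Fin (N j),
        (Ico (k * (T / N j)) ((k + 1) * (T / N j)) : Set ℝ) := fun t ht =>
      mem_iUnion.2 ⟨⟨cell j t, hlt j t ht⟩, hmem j t ht⟩
    calc ∫⁻ t in Ico 0 T, ‖W j t‖ₑ
        ≤ ∫⁻ t in ⋃ k : Fin (N j),
            (Ico (k * (T / N j)) ((k + 1) * (T / N j)) : Set ℝ), ‖W j t‖ₑ :=
          lintegral_mono_set hcover
      _ ≤ ∑ k : Fin (N j),
            ∫⁻ t in Ico (k * (T / N j)) ((k + 1) * (T / N j)), ‖W j t‖ₑ := by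
          refine (lintegral_iUnion_le _ _).trans_eq (tsum_fintype _)
      _ = ∑ k ∈ Finset.range (N j), ENNReal.ofReal (T / N j * ω j k) := by
          rw [Finset.sum_range]
          refine Finset.sum_congr rfl fun k _ => ?_
          have : ∀ t ∈ Ico ((k : ℝ) * (T / N j)) ((k + 1) * (T / N j)),
              ‖W j t‖ₑ = ENNReal.ofReal (ω j k) := by
            intro t ht
            have hk0 : cell j t = k := by
              have h0 : 0 ≤ t := le_trans (by have := hh j; positivity) ht.1
              rw [hcell, Nat.floor_eq_iff (div_nonneg h0 (hh j).le), le_div_iff₀ (hh j),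
                div_lt_iff₀ (hh j)]
              exact ht
            rw [hW]
            simp only [hk0]
            exact Real.enorm_of_nonneg (hω0 j k k.2)
          rw [setLIntegral_congr_fun measurableSet_Ico this, setLIntegral_const, Real.volume_Ico,
            ← ENNReal.ofReal_mul (hω0 j k k.2)]
          congr 1
          ring
      _ = ENNReal.ofReal (T / N j * ∑ k ∈ Finset.range (N j), ω j k) := by
          rw [Finset.mul_sum, ENNReal.ofReal_sum_of_nonneg]
          intro k hk
          exact mul_nonneg (hh j).le (hω0 j k (Finset.mem_range.1 hk))
      _ ≤ ENNReal.ofReal (T * (1 / (j + 1))) := by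
          apply ENNReal.ofReal_le_ofReal
          calc T / N j * ∑ k ∈ Finset.range (N j), ω j k
              ≤ T / N j * (1 / (j + 1) * N j) := by gcongr; exact hsum j
            _ = T * (1 / (j + 1)) := by
              have := (hNR j).ne'
              field_simp
  have hlim : Tendsto (fun j => eLpNorm (W j - 0) 1 (volume.restrict (Ico 0 T))) atTop (𝓝 0) := by
    refine tendsto_of_tendsto_of_tendsto_of_le_of_le tendsto_const_nhds ?_ (fun _ => zero_le)
      hint
    rw [← ENNReal.ofReal_zero]
    apply ENNReal.tendsto_ofReal
    simpa using (tendsto_one_div_add_atTop_nhds_zero_nat (𝕜 := ℝ)).const_mul T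
  obtain ⟨ns, -, hns⟩ := (tendstoInMeasure_of_tendsto_eLpNorm one_ne_zero
    (fun j => (hWm j).aestronglyMeasurable) aestronglyMeasurable_const hlim).exists_seq_tendsto_ae
  refine aestronglyMeasurable_of_tendsto_ae atTop
    (fun i => (hgm (ns i)).aestronglyMeasurable) ?_
  filter_upwards [hns, ae_restrict_mem measurableSet_Ico] with t ht htm
  rw [tendsto_iff_dist_tendsto_zero]
  exact squeeze_zero (fun _ => dist_nonneg) (fun i => hclose (ns i) t htm) ht

/-! ### Left eigenvectors and the decoupling of the methods -/

/-- A lower triangular matrix with pairwise distinct diagonal entries has a basis of left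
eigenvectors, the rows of `Q`. -/
lemma Matrix.IsLowerTriangular.exists_isUnit_mul_eq_diagonal_mul {n K : Type*} [Fintype n]
    [LinearOrder n] [Field K] {A : Matrix n n K} (hA : A.IsLowerTriangular)
    (hd : Function.Injective A.diag) :
    ∃ Q : Matrix n n K, IsUnit Q ∧ Q * A = Matrix.diagonal A.diag * Q := by
  -- `A - A i i` is lower triangular with a zero on the diagonal, hence singular.
  have hev : ∀ i, ∃ v : n → K, v ≠ 0 ∧ v ᵥ* A = A.diag i • v := by
    intro i
    have hdet : (A - A.diag i • (1 : Matrix n n K)).det = 0 := by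
      rw [Matrix.det_of_isLowerTriangular]
      · exact Finset.prod_eq_zero (Finset.mem_univ i) (by simp)
      · intro j l hjl
        have h0 : A j l = 0 := hA hjl
        have hne : j ≠ l := by
          rintro rfl
          exact lt_irrefl _ hjl
        simp [h0, hne]
    obtain ⟨v, hv, hv0⟩ := Matrix.exists_vecMul_eq_zero_iff.2 hdet
    refine ⟨v, hv, ?_⟩
    rw [Matrix.vecMul_sub, Matrix.vecMul_smul, Matrix.vecMul_one] at hv0
    exact sub_eq_zero.1 hv0
  choose v hv0 hv using hev
  refine ⟨Matrix.of v, ?_, ?_⟩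
  · rw [← Matrix.linearIndependent_rows_iff_isUnit]
    refine Module.End.eigenvectors_linearIndependent' A.vecMulLinear A.diag hd v fun i => ?_
    exact ⟨Module.End.mem_eigenspace_iff.2 (hv i), hv0 i⟩
  · ext i j
    rw [Matrix.diagonal_mul]
    exact congrFun (hv i) j

lemma exists_isUnit_mul_legSA (N : ℕ) : ∃ Q : Matrix (Fin N) (Fin N) ℝ, IsUnit Q ∧
    Q * legSA N = Matrix.diagonal (fun i : Fin N => (i : ℝ) + 1) * Q := by
  have hdiag : (legSA N).diag = fun i : Fin N => (i : ℝ) + 1 := by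
    ext i
    simp [legSA]
  have hA : (legSA N).IsLowerTriangular := by
    intro i j hij
    have hij' : i < j := hij
    simp [legSA, hij'.not_gt, hij'.ne]
  have := hA.exists_isUnit_mul_eq_diagonal_mul (by
    rw [hdiag]
    intro i j hij
    have : (i : ℝ) = j := by simpa using hij
    exact Fin.ext (by exact_mod_cast this))
  rwa [hdiag] at this

section Intertwining

/-! An identity `Q M = diag(e) Q` says that the rows of `Q` are left eigenvectors of `M` with
eigenvalues `e i`; it passes from `M` to functions of `M`. -/

variable {n : Type*} [Fintype n] [DecidableEq n] {Q M : Matrix n n ℝ} {e : n → ℝ}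

lemma mulVec_mulVec_of_mul_eq_diagonal_mul (h : Q * M = Matrix.diagonal e * Q) (v : n → ℝ)
    (i : n) : (Q *ᵥ (M *ᵥ v)) i = e i * (Q *ᵥ v) i := by
  rw [Matrix.mulVec_mulVec, h, ← Matrix.mulVec_mulVec, Matrix.mulVec_diagonal]

lemma mul_one_add_smul_of_mul_eq_diagonal_mul (h : Q * M = Matrix.diagonal e * Q) (a : ℝ) :
    Q * (1 + a • M) = Matrix.diagonal (fun i => 1 + a * e i) * Q := by
  have : Matrix.diagonal (fun i => 1 + a * e i) = 1 + a • Matrix.diagonal e := by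
    ext i j
    by_cases hij : i = j <;> simp [hij]
  rw [this, mul_add, add_mul, mul_smul_comm, h, smul_mul_assoc, mul_one, one_mul]

lemma mul_one_sub_smul_of_mul_eq_diagonal_mul (h : Q * M = Matrix.diagonal e * Q) (a : ℝ) :
    Q * (1 - a • M) = Matrix.diagonal (fun i => 1 - a * e i) * Q := by
  simpa [sub_eq_add_neg] using mul_one_add_smul_of_mul_eq_diagonal_mul h (-a)

lemma mul_inv_of_mul_eq_diagonal_mul (hQ : IsUnit Q) (h : Q * M = Matrix.diagonal e * Q)
    (he : ∀ i, e i ≠ 0) : Q * M⁻¹ = Matrix.diagonal (fun i => (e i)⁻¹) * Q := by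
  have hQd : Q.det ≠ 0 := ((Matrix.isUnit_iff_isUnit_det _).1 hQ).ne_zero
  have hM : IsUnit M.det := by
    have h1 := congrArg Matrix.det h
    rw [Matrix.det_mul, Matrix.det_mul, Matrix.det_diagonal, mul_comm] at h1
    rw [mul_right_cancel₀ hQd h1]
    exact (Finset.prod_ne_zero_iff.2 fun i _ => he i).isUnit
  have h2 : Matrix.diagonal (fun i => (e i)⁻¹) * Matrix.diagonal e = 1 := by
    rw [Matrix.diagonal_mul_diagonal, ← Matrix.diagonal_one]
    congr 1
    ext i
    exact inv_mul_cancel₀ (he i)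
  calc Q * M⁻¹ = Matrix.diagonal (fun i => (e i)⁻¹) * (Matrix.diagonal e * Q) * M⁻¹ := by
        rw [← mul_assoc, h2, one_mul]
    _ = Matrix.diagonal (fun i => (e i)⁻¹) * Q := by
        rw [← h, ← mul_assoc, Matrix.mul_nonsing_inv_cancel_right _ _ hM]

lemma mul_exp_of_mul_eq_diagonal_mul (hQ : IsUnit Q) (h : Q * M = Matrix.diagonal e * Q)
    (a : ℝ) : Q * NormedSpace.exp (a • M) = Matrix.diagonal (fun i => Real.exp (a * e i)) * Q := by
  have hQd : IsUnit Q.det := (Matrix.isUnit_iff_isUnit_det _).1 hQ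
  have h1 : a • M = Q⁻¹ * Matrix.diagonal (fun i => a * e i) * Q := by
    have : Matrix.diagonal (fun i => a * e i) = a • Matrix.diagonal e := by
      rw [← Matrix.diagonal_smul]; rfl
    rw [this, mul_assoc, smul_mul_assoc, ← h, mul_smul_comm, ← mul_assoc,
      Matrix.nonsing_inv_mul _ hQd, one_mul]
  rw [h1, Matrix.exp_conj' _ _ hQ, Matrix.exp_diagonal, ← mul_assoc, ← mul_assoc,
    Matrix.mul_nonsing_inv _ hQd, one_mul]
  congr 2
  ext i
  rw [Real.exp_eq_exp_ℝ, Pi.coe_exp]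

end Intertwining

/-- The factor by which the step `k` of a method multiplies the component of `c` along a left
eigenvector of `A` for the eigenvalue `m + 1`. -/
noncomputable def legSMult (s : LegSScheme) (m k : ℕ) : ℝ :=
  match s with
  | .forwardEuler => if k = 0 then 1 else 1 - 1 / (k : ℝ) * ((m : ℝ) + 1)
  | .backwardEuler => (1 + 1 / ((k : ℝ) + 1) * ((m : ℝ) + 1))⁻¹
  | .bilinear =>
      if k = 0 then (1 + (1 / 2 : ℝ) * ((m : ℝ) + 1))⁻¹
      else (1 + 1 / (2 * ((k : ℝ) + 1)) * ((m : ℝ) + 1))⁻¹ *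
        (1 - 1 / (2 * (k : ℝ)) * ((m : ℝ) + 1))
  | .approxBilinear =>
      (1 + 1 / (2 * ((k : ℝ) + 1)) * ((m : ℝ) + 1))⁻¹ *
        (1 - 1 / (2 * ((k : ℝ) + 1)) * ((m : ℝ) + 1))
  | .zeroOrderHold => ((k : ℝ) / ((k : ℝ) + 1)) ^ (m + 1)

/-- The weight of the left sample `f^k` in the step `k` of a method, along a left eigenvector of
`A` for the eigenvalue `m + 1`. -/
noncomputable def legSWeightLeft (s : LegSScheme) (m k : ℕ) : ℝ :=
  match s with
  | .forwardEuler => if k = 0 then 0 else 1 / (k : ℝ)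
  | .backwardEuler => 0
  | .bilinear =>
      if k = 0 then 0
      else (1 + 1 / (2 * ((k : ℝ) + 1)) * ((m : ℝ) + 1))⁻¹ * (1 / (2 * (k : ℝ)))
  | .approxBilinear => 0
  | .zeroOrderHold => ((m : ℝ) + 1)⁻¹ * (1 - ((k : ℝ) / ((k : ℝ) + 1)) ^ (m + 1))

/-- The weight of the right sample `f^{k+1}` in the step `k` of a method, along a left eigenvector
of `A` for the eigenvalue `m + 1`. -/
noncomputable def legSWeightRight (s : LegSScheme) (m k : ℕ) : ℝ :=
  match s with
  | .forwardEuler => 0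
  | .backwardEuler => (1 + 1 / ((k : ℝ) + 1) * ((m : ℝ) + 1))⁻¹ * (1 / ((k : ℝ) + 1))
  | .bilinear => (1 + 1 / (2 * ((k : ℝ) + 1)) * ((m : ℝ) + 1))⁻¹ * (1 / (2 * ((k : ℝ) + 1)))
  | .approxBilinear => (1 + 1 / (2 * ((k : ℝ) + 1)) * ((m : ℝ) + 1))⁻¹ * (1 / ((k : ℝ) + 1))
  | .zeroOrderHold => 0

/-- In a basis of left eigenvectors of `A` every method acts diagonally. -/
lemma mulVec_legSStep {N : ℕ} {Q : Matrix (Fin N) (Fin N) ℝ} (hQ : IsUnit Q)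
    (h : Q * legSA N = Matrix.diagonal (fun i : Fin N => (i : ℝ) + 1) * Q) (s : LegSScheme)
    (k : ℕ) (u v : ℝ) (c : Fin N → ℝ) (i : Fin N) :
    (Q *ᵥ legSStep N s k u v c) i = legSMult s i k * (Q *ᵥ c) i
      + (legSWeightLeft s i k * u + legSWeightRight s i k * v) * (Q *ᵥ legSB N) i := by
  have hinv : ∀ (a : ℝ), 0 ≤ a → ∀ (w : Fin N → ℝ) (i : Fin N),
      (Q *ᵥ ((1 + a • legSA N)⁻¹ *ᵥ w)) i = (1 + a * ((i : ℝ) + 1))⁻¹ * (Q *ᵥ w) i := by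
    intro a ha w i
    exact mulVec_mulVec_of_mul_eq_diagonal_mul (mul_inv_of_mul_eq_diagonal_mul hQ
      (mul_one_add_smul_of_mul_eq_diagonal_mul h a) fun i => by positivity) w i
  have hsub : ∀ (a : ℝ) (w : Fin N → ℝ) (i : Fin N),
      (Q *ᵥ ((1 - a • legSA N) *ᵥ w)) i = (1 - a * ((i : ℝ) + 1)) * (Q *ᵥ w) i := fun a w i =>
    mulVec_mulVec_of_mul_eq_diagonal_mul (mul_one_sub_smul_of_mul_eq_diagonal_mul h a) w i
  cases s with
  | forwardEuler =>
    by_cases hk : k = 0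
    · simp [legSStep, legSMult, legSWeightLeft, legSWeightRight, hk]
    · simp only [legSStep, legSMult, legSWeightLeft, legSWeightRight, hk, if_false,
        Matrix.mulVec_add, Matrix.mulVec_smul, Pi.add_apply, Pi.smul_apply, smul_eq_mul, hsub]
      ring
  | backwardEuler =>
    simp only [legSStep, legSMult, legSWeightLeft, legSWeightRight,
      Matrix.mulVec_add, Pi.add_apply]
    rw [hinv _ (by positivity), hinv _ (by positivity)]
    simp only [Matrix.mulVec_smul, Pi.smul_apply, smul_eq_mul]
    ring
  | bilinear =>
    by_cases hk : k = 0
    · simp only [legSStep, legSMult, legSWeightLeft, legSWeightRight, hk, if_true,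
        Matrix.mulVec_add, Pi.add_apply, Matrix.mulVec_smul, Pi.smul_apply, smul_eq_mul]
      rw [hinv _ (by positivity), hinv _ (by positivity)]
      push_cast
      ring
    · simp only [legSStep, legSMult, legSWeightLeft, legSWeightRight, hk, if_false,
        Matrix.mulVec_add, Pi.add_apply]
      rw [hinv _ (by positivity), hinv _ (by positivity), hsub]
      simp only [Matrix.mulVec_smul, Pi.smul_apply, smul_eq_mul]
      ring
  | approxBilinear =>
    simp only [legSStep, legSMult, legSWeightLeft, legSWeightRight,
      Matrix.mulVec_add, Pi.add_apply]
    rw [hinv _ (by positivity), hinv _ (by positivity), hsub]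
    simp only [Matrix.mulVec_smul, Pi.smul_apply, smul_eq_mul]
    ring
  | zeroOrderHold =>
    have hexp : ∀ (w : Fin N → ℝ) (i : Fin N), (Q *ᵥ (legSExp N k *ᵥ w)) i
        = ((k : ℝ) / ((k : ℝ) + 1)) ^ ((i : ℕ) + 1) * (Q *ᵥ w) i := by
      intro w i
      by_cases hk : k = 0
      · simp [legSExp, hk]
      · have hk' : (0 : ℝ) < k := by exact_mod_cast Nat.pos_of_ne_zero hk
        rw [legSExp, if_neg hk, mulVec_mulVec_of_mul_eq_diagonal_mul
          (mul_exp_of_mul_eq_diagonal_mul hQ h _)]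
        congr 1
        rw [mul_comm, show ((i : ℝ) + 1) = (((i : ℕ) + 1 : ℕ) : ℝ) by push_cast; rfl,
          Real.exp_nat_mul, Real.exp_log (by positivity)]
    have hA : ∀ (w : Fin N → ℝ) (i : Fin N),
        (Q *ᵥ ((legSA N)⁻¹ *ᵥ w)) i = ((i : ℝ) + 1)⁻¹ * (Q *ᵥ w) i := fun w i =>
      mulVec_mulVec_of_mul_eq_diagonal_mul (mul_inv_of_mul_eq_diagonal_mul hQ h
        fun i => by positivity) w i
    simp only [legSStep, legSMult, legSWeightLeft, legSWeightRight, Matrix.mulVec_add,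
      Pi.add_apply, hA, hexp, Matrix.sub_mulVec, Matrix.mulVec_sub, Pi.sub_apply,
      Matrix.one_mulVec, Matrix.mulVec_smul, Pi.smul_apply, smul_eq_mul]
    ring

/-! ### Consistency of the five methods -/

/-- A second order Bernoulli estimate. -/
lemma one_sub_pow_le {x : ℝ} (hx0 : 0 ≤ x) (hx1 : x ≤ 1) (n : ℕ) :
    (1 - x) ^ n ≤ 1 - n * x + (n : ℝ) ^ 2 * x ^ 2 := by
  induction n with
  | zero => simp
  | succ n ih =>
    rw [pow_succ]
    refine (mul_le_mul_of_nonneg_right ih (by linarith)).trans ?_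
    push_cast
    have h1 : (0 : ℝ) ≤ (n : ℝ) ^ 2 * x ^ 3 := by positivity
    have h2 : (0 : ℝ) ≤ ((n : ℝ) + 1) * x ^ 2 := by positivity
    nlinarith

lemma abs_one_sub_pow_sub_le {x : ℝ} (hx0 : 0 ≤ x) (hx1 : x ≤ 1) (n : ℕ) :
    |(1 - x) ^ n - (1 - n * x)| ≤ (n : ℝ) ^ 2 * x ^ 2 := by
  have h1 := one_sub_pow_le hx0 hx1 n
  have h2 := one_add_mul_le_pow (a := -x) (by linarith) n
  rw [← sub_eq_add_neg] at h2
  have h3 : (0 : ℝ) ≤ (n : ℝ) ^ 2 * x ^ 2 := by positivity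
  rw [abs_le]
  constructor <;> nlinarith

/-- The factor `(k/(k+1))^{m+1}` of the exact solution is `1 - (m+1)/(k+1)` up to second order. -/
lemma abs_natCast_div_pow_sub_le (m k : ℕ) :
    |((k : ℝ) / (k + 1)) ^ (m + 1) - (1 - ((m : ℝ) + 1) / (k + 1))|
      ≤ ((m : ℝ) + 1) ^ 2 / ((k : ℝ) + 1) ^ 2 := by
  have hk : (0 : ℝ) < k + 1 := by positivity
  have h := abs_one_sub_pow_sub_le (x := 1 / ((k : ℝ) + 1)) (by positivity)
    (by rw [div_le_one hk]; linarith [(Nat.cast_nonneg k : (0 : ℝ) ≤ k)]) (m + 1)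
  have h1 : 1 - 1 / ((k : ℝ) + 1) = k / (k + 1) := by field_simp; ring
  rw [h1] at h
  push_cast at h
  rw [mul_one_div, one_div_pow, mul_one_div] at h
  exact h

/-- The total weight of the input over one cell in the exact solution is `1/(k+1)` up to second
order. -/
lemma abs_weight_natCast_div_pow_sub_le (m k : ℕ) :
    |((m : ℝ) + 1)⁻¹ * (1 - ((k : ℝ) / (k + 1)) ^ (m + 1)) - 1 / (k + 1)|
      ≤ ((m : ℝ) + 1) / ((k : ℝ) + 1) ^ 2 := by
  have hm : (0 : ℝ) < m + 1 := by positivity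
  have h := abs_natCast_div_pow_sub_le m k
  have h1 : ((m : ℝ) + 1)⁻¹ * (1 - ((k : ℝ) / (k + 1)) ^ (m + 1)) - 1 / (k + 1)
      = -(((m : ℝ) + 1)⁻¹ *
        (((k : ℝ) / (k + 1)) ^ (m + 1) - (1 - ((m : ℝ) + 1) / (k + 1)))) := by
    field_simp
    ring
  rw [h1, abs_neg, abs_mul, abs_of_pos (inv_pos.2 hm), inv_mul_le_iff₀ hm]
  exact h.trans_eq (by ring)

/-- Clearing the resolvent `(1 + y)⁻¹`, `y ≥ 0`, of an implicit step: it is at most `1`, so the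
residual of the implicit equation bounds the difference. -/
lemma abs_inv_one_add_mul_sub_le {y a b C : ℝ} (hy : 0 ≤ y) (h : |a - (1 + y) * b| ≤ C) :
    |(1 + y)⁻¹ * a - b| ≤ C := by
  have h1 : (1 + y)⁻¹ * a - b = (1 + y)⁻¹ * (a - (1 + y) * b) := by
    have : (1 + y) ≠ 0 := by positivity
    field_simp
  rw [h1, abs_mul, abs_of_pos (by positivity : (0 : ℝ) < (1 + y)⁻¹)]
  have h2 : (1 + y)⁻¹ ≤ 1 := inv_le_one_of_one_le₀ (by linarith)
  nlinarith [abs_nonneg (a - (1 + y) * b)]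

/-- `x = 1 / (k + 1)` and `y = 1 / k` agree up to second order. -/
lemma one_div_sub_one_div_succ {k : ℕ} (hk : k ≠ 0) :
    0 ≤ 1 / (k : ℝ) - 1 / (k + 1) ∧ 1 / (k : ℝ) - 1 / (k + 1) ≤ 2 * (1 / ((k : ℝ) + 1)) ^ 2 := by
  have hk1 : (1 : ℝ) ≤ k := by exact_mod_cast Nat.one_le_iff_ne_zero.2 hk
  have hk0 : (0 : ℝ) < k := by linarith
  have h : 1 / (k : ℝ) - 1 / (k + 1) = 1 / (k * (k + 1)) := by field_simp; ring
  rw [h]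
  refine ⟨by positivity, ?_⟩
  rw [div_pow, one_pow, mul_one_div, div_le_div_iff₀ (by positivity) (by positivity)]
  nlinarith

/-- Every method multiplies by `1 - λ/(k+1)` up to second order, `λ` being the eigenvalue. -/
lemma abs_legSMult_sub_le (s : LegSScheme) (m k : ℕ) :
    |legSMult s m k - (1 - ((m : ℝ) + 1) / (k + 1))|
      ≤ 2 * ((m : ℝ) + 1) ^ 2 / ((k : ℝ) + 1) ^ 2 := by
  obtain ⟨L, hL⟩ : ∃ L : ℝ, L = (m : ℝ) + 1 := ⟨_, rfl⟩
  obtain ⟨x, hx⟩ : ∃ x : ℝ, x = 1 / ((k : ℝ) + 1) := ⟨_, rfl⟩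
  have hL1 : 1 ≤ L := by rw [hL]; linarith [(Nat.cast_nonneg m : (0 : ℝ) ≤ m)]
  have hx0 : 0 < x := by rw [hx]; positivity
  have hx2 : 1 / (2 * ((k : ℝ) + 1)) = x / 2 := by rw [hx]; field_simp
  have e1 : ((m : ℝ) + 1) / (k + 1) = L * x := by rw [hL, hx]; ring
  have e2 : 2 * ((m : ℝ) + 1) ^ 2 / ((k : ℝ) + 1) ^ 2 = 2 * L ^ 2 * x ^ 2 := by
    rw [hL, hx, div_pow, one_pow, mul_one_div]
  have hxL : 0 ≤ x * L := by positivity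
  have hxL2 : 0 ≤ (x * L) ^ 2 := by positivity
  have hLx2 : L * x ^ 2 ≤ L ^ 2 * x ^ 2 := by nlinarith [sq_nonneg x]
  cases s with
  | zeroOrderHold =>
    refine (abs_natCast_div_pow_sub_le m k).trans ?_
    gcongr
    nlinarith [sq_nonneg ((m : ℝ) + 1)]
  | backwardEuler =>
    rw [e1, e2, legSMult, ← hx, ← hL, ← mul_one (1 + x * L)⁻¹]
    refine abs_inv_one_add_mul_sub_le hxL (abs_le.2 ⟨?_, ?_⟩) <;> nlinarith
  | approxBilinear =>
    rw [e1, e2, legSMult, hx2, ← hL]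
    refine abs_inv_one_add_mul_sub_le (by positivity) (abs_le.2 ⟨?_, ?_⟩) <;> nlinarith
  | forwardEuler =>
    by_cases hk : k = 0
    · have hx1 : x = 1 := by rw [hx, hk]; simp
      rw [e1, e2, legSMult, if_pos hk, hx1, abs_le]
      constructor <;> nlinarith
    · obtain ⟨h1, h2⟩ := one_div_sub_one_div_succ hk
      rw [e1, e2, legSMult, if_neg hk, ← hL, abs_le]
      rw [← hx] at h1 h2
      constructor <;> nlinarith
  | bilinear =>
    by_cases hk : k = 0
    · have hx1 : x = 1 := by rw [hx, hk]; simp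
      rw [e1, e2, legSMult, if_pos hk, hx1, ← hL, ← mul_one (1 + 1 / 2 * L)⁻¹]
      refine abs_inv_one_add_mul_sub_le (by positivity) (abs_le.2 ⟨?_, ?_⟩) <;> nlinarith
    · obtain ⟨h1, h2⟩ := one_div_sub_one_div_succ hk
      have hy2 : 1 / (2 * (k : ℝ)) = 1 / k / 2 := by ring
      rw [e1, e2, legSMult, if_neg hk, ← hL, hx2, hy2]
      rw [← hx] at h1 h2
      refine abs_inv_one_add_mul_sub_le (by positivity) (abs_le.2 ⟨?_, ?_⟩) <;> nlinarith

/-- In every method the samples have total weight `1/(k+1)` up to second order. -/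
lemma abs_legSWeight_sub_le (s : LegSScheme) (m k : ℕ) :
    |legSWeightLeft s m k + legSWeightRight s m k - 1 / (k + 1)|
      ≤ 2 * ((m : ℝ) + 1) / ((k : ℝ) + 1) ^ 2 := by
  obtain ⟨L, hL⟩ : ∃ L : ℝ, L = (m : ℝ) + 1 := ⟨_, rfl⟩
  obtain ⟨x, hx⟩ : ∃ x : ℝ, x = 1 / ((k : ℝ) + 1) := ⟨_, rfl⟩
  have hL1 : 1 ≤ L := by rw [hL]; linarith [(Nat.cast_nonneg m : (0 : ℝ) ≤ m)]
  have hx0 : 0 < x := by rw [hx]; positivity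
  have hx2 : 1 / (2 * ((k : ℝ) + 1)) = x / 2 := by rw [hx]; field_simp
  have e2 : 2 * ((m : ℝ) + 1) / ((k : ℝ) + 1) ^ 2 = 2 * L * x ^ 2 := by
    rw [hL, hx, div_pow, one_pow, mul_one_div]
  have hxL : 0 ≤ x * L := by positivity
  have hLx2 : x ^ 2 ≤ L * x ^ 2 := by nlinarith [sq_nonneg x]
  cases s with
  | zeroOrderHold =>
    rw [legSWeightLeft, legSWeightRight, add_zero]
    refine (abs_weight_natCast_div_pow_sub_le m k).trans ?_
    gcongr
    linarith [(Nat.cast_nonneg m : (0 : ℝ) ≤ m)]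
  | backwardEuler =>
    rw [e2, legSWeightLeft, legSWeightRight, zero_add, ← hx, ← hL]
    refine abs_inv_one_add_mul_sub_le hxL (abs_le.2 ⟨?_, ?_⟩) <;> nlinarith
  | approxBilinear =>
    rw [e2, legSWeightLeft, legSWeightRight, zero_add, hx2, ← hx, ← hL]
    refine abs_inv_one_add_mul_sub_le (by positivity) (abs_le.2 ⟨?_, ?_⟩) <;> nlinarith
  | forwardEuler =>
    by_cases hk : k = 0
    · have hx1 : x = 1 := by rw [hx, hk]; simp
      rw [e2, legSWeightLeft, legSWeightRight, if_pos hk, ← hx, hx1, abs_le]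
      constructor <;> nlinarith
    · obtain ⟨h1, h2⟩ := one_div_sub_one_div_succ hk
      rw [e2, legSWeightLeft, legSWeightRight, if_neg hk, ← hx, abs_le]
      rw [← hx] at h1 h2
      constructor <;> nlinarith
  | bilinear =>
    by_cases hk : k = 0
    · have hx1 : x = 1 := by rw [hx, hk]; simp
      rw [e2, legSWeightLeft, legSWeightRight, if_pos hk, zero_add, hx2, ← hx, ← hL, hx1]
      refine abs_inv_one_add_mul_sub_le (by positivity) (abs_le.2 ⟨?_, ?_⟩) <;> nlinarith
    · obtain ⟨h1, h2⟩ := one_div_sub_one_div_succ hk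
      have hy2 : 1 / (2 * (k : ℝ)) = 1 / k / 2 := by ring
      rw [e2, legSWeightLeft, legSWeightRight, if_neg hk, ← mul_add, hx2, hy2, ← hx, ← hL]
      rw [← hx] at h1 h2
      refine abs_inv_one_add_mul_sub_le (by positivity) (abs_le.2 ⟨?_, ?_⟩) <;> nlinarith

lemma abs_legSWeightRight_le (s : LegSScheme) (m k : ℕ) :
    |legSWeightRight s m k| ≤ 1 / ((k : ℝ) + 1) := by
  have h : ∀ {y z : ℝ}, 0 ≤ y → 0 ≤ z → z ≤ 1 / ((k : ℝ) + 1) →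
      |(1 + y)⁻¹ * z| ≤ 1 / ((k : ℝ) + 1) := by
    intro y z hy hz hzk
    rw [abs_of_nonneg (by positivity)]
    have h2 : (1 + y)⁻¹ ≤ 1 := inv_le_one_of_one_le₀ (by linarith)
    nlinarith
  have h2 : 1 / (2 * ((k : ℝ) + 1)) ≤ 1 / ((k : ℝ) + 1) :=
    one_div_le_one_div_of_le (by positivity) (by linarith [(Nat.cast_nonneg k : (0 : ℝ) ≤ k)])
  cases s with
  | forwardEuler => simp only [legSWeightRight, abs_zero]; positivity
  | zeroOrderHold => simp only [legSWeightRight, abs_zero]; positivity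
  | backwardEuler => exact h (by positivity) (by positivity) le_rfl
  | approxBilinear => exact h (by positivity) (by positivity) le_rfl
  | bilinear => exact h (by positivity) (by positivity) h2

/-! ### Stability of the error recursion -/

/-- A recursion that contracts by `1 - 1/(k+1)` up to second order and has a source of size
`W/(k+1)` is bounded: once `k + 1 ≥ 2C` the contraction is at least `1 - 1/(2(k+1))`, whose
equilibrium with the source is `2W`. -/
lemma exists_bound_of_recursive_bound {C : ℝ} (hC : 1 ≤ C) (r W : ℝ) :
    ∃ R : ℝ, ∀ (e : ℕ → ℝ) (n : ℕ), e 0 ≤ r →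
      (∀ k < n, e (k + 1) ≤ (1 - 1 / ((k : ℝ) + 1) + C / ((k : ℝ) + 1) ^ 2) * e k
        + W / ((k : ℝ) + 1)) → ∀ k ≤ n, e k ≤ R := by
  set a : ℕ → ℝ := fun k => 1 - 1 / ((k : ℝ) + 1) + C / ((k : ℝ) + 1) ^ 2 with ha
  have ha0 : ∀ k, 0 ≤ a k := by
    intro k
    have h1 : a k = 1 - 1 / ((k : ℝ) + 1) + C * (1 / ((k : ℝ) + 1)) ^ 2 := by
      rw [one_div_pow, mul_one_div]
    rw [h1]
    nlinarith [sq_nonneg (1 - 1 / ((k : ℝ) + 1)), sq_nonneg (1 / ((k : ℝ) + 1))]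
  set S : ℕ → ℝ := fun k => Nat.rec r (fun k s => a k * s + W / ((k : ℝ) + 1)) k with hS
  have hSs : ∀ k, S (k + 1) = a k * S k + W / ((k : ℝ) + 1) := fun k => rfl
  -- `S` is the recursion with equality, which dominates every such `e`.
  have hbdd : BddAbove (range S) := by
    obtain ⟨k₀, hk₀⟩ := exists_nat_ge (2 * C)
    refine (isBoundedUnder_of_eventually_le (a := max (S k₀) (max (2 * W) 0)) ?_).bddAbove_range
    filter_upwards [eventually_ge_atTop k₀] with k hk
    induction k, hk using Nat.le_induction with
    | base => exact le_max_left _ _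
    | succ k hk ih =>
      set B := max (S k₀) (max (2 * W) 0) with hB
      have hB0 : 0 ≤ B := (le_max_right _ _).trans (le_max_right _ _)
      have hBW : 2 * W ≤ B := (le_max_left _ _).trans (le_max_right _ _)
      have hkR : (k₀ : ℝ) ≤ k := by exact_mod_cast hk
      have hk1 : (0 : ℝ) < (k : ℝ) + 1 := by positivity
      have hak : a k ≤ 1 - 1 / (2 * ((k : ℝ) + 1)) := by
        have h1 : C / ((k : ℝ) + 1) ^ 2 ≤ 1 / (2 * ((k : ℝ) + 1)) := by
          rw [div_le_div_iff₀ (by positivity) (by positivity)]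
          nlinarith
        have h2 : 1 / ((k : ℝ) + 1) = 2 * (1 / (2 * ((k : ℝ) + 1))) := by field_simp
        rw [ha]
        simp only
        linarith
      calc S (k + 1) = a k * S k + W / ((k : ℝ) + 1) := hSs k
        _ ≤ a k * B + W / ((k : ℝ) + 1) := by
            have := mul_le_mul_of_nonneg_left ih (ha0 k)
            linarith
        _ ≤ (1 - 1 / (2 * ((k : ℝ) + 1))) * B + B / 2 / ((k : ℝ) + 1) := by
            gcongr
            linarith
        _ = B := by field_simp; ring
  obtain ⟨R, hR⟩ := hbdd
  refine ⟨R, fun e n h0 hstep k hk => ?_⟩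
  have : e k ≤ S k := by
    induction k with
    | zero => exact h0
    | succ k ih =>
      rw [hSs]
      refine (hstep k (by omega)).trans ?_
      have := mul_le_mul_of_nonneg_left (ih (by omega)) (ha0 k)
      linarith
  exact this.trans (hR ⟨k, rfl⟩)

/-- Stability and consistency give convergence. Multiplied by `k + 1`, the recursion for the error
telescopes; the second order terms contribute a multiple of a harmonic sum, and the oscillation
terms `ω` contribute `o(n)`. -/
lemma tendsto_zero_of_recursive_bound {e : ℕ → ℕ → ℝ} {C D r W : ℝ} (hC : 1 ≤ C) (hD : 0 ≤ D)
    (he : ∀ n k, 0 ≤ e n k) (h0 : ∀ n, e n 0 ≤ r)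
    (hW : ∀ n, ∀ k < n, e n (k + 1) ≤
      (1 - 1 / ((k : ℝ) + 1) + C / ((k : ℝ) + 1) ^ 2) * e n k + W / ((k : ℝ) + 1))
    (hω : ∀ ε > 0, ∃ n₀ : ℕ, ∀ n ≥ n₀, ∃ ω : ℕ → ℝ, (∀ k < n, e n (k + 1) ≤
        (1 - 1 / ((k : ℝ) + 1) + C / ((k : ℝ) + 1) ^ 2) * e n k
          + D / ((k : ℝ) + 1) ^ 2 + D * ω k / ((k : ℝ) + 1)) ∧
      ∑ k ∈ Finset.range n, ω k ≤ ε * n) :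
    Tendsto (fun n => e n n) atTop (𝓝 0) := by
  obtain ⟨R, hR⟩ := exists_bound_of_recursive_bound hC r W
  have heR : ∀ n, ∀ k ≤ n, e n k ≤ R := fun n => hR (e n) n (h0 n) (hW n)
  have hR0 : 0 ≤ R := (he 0 0).trans (heR 0 0 le_rfl)
  have hces : Tendsto (fun n : ℕ => (C * R + D) *
      ((n : ℝ)⁻¹ * ∑ k ∈ Finset.range n, 1 / ((k : ℝ) + 1))) atTop (𝓝 0) := by
    simpa using ((tendsto_one_div_add_atTop_nhds_zero_nat (𝕜 := ℝ)).cesaro).const_mul (C * R + D)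
  rw [Metric.tendsto_atTop]
  intro ε hε
  obtain ⟨n₁, hn₁⟩ := Metric.tendsto_atTop.1 hces (ε / 2) (by positivity)
  obtain ⟨n₀, hn₀⟩ := hω (ε / (2 * (D + 1))) (by positivity)
  refine ⟨max (max n₀ n₁) 1, fun n hn => ?_⟩
  have hnn₀ : n₀ ≤ n := (le_max_left _ _).trans ((le_max_left _ _).trans hn)
  have hnn₁ : n₁ ≤ n := (le_max_right _ _).trans ((le_max_left _ _).trans hn)
  have hn1 : 1 ≤ n := (le_max_right _ _).trans hn
  have hnR : (0 : ℝ) < n := by exact_mod_cast hn1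
  obtain ⟨ω, hstep, hsum⟩ := hn₀ n hnn₀
  -- `(k + 1) (1 - 1/(k+1)) = k`, so the leading part of the recursion for `k e_k` telescopes.
  have htel : ∀ j ≤ n, (j : ℝ) * e n j ≤
      (C * R + D) * ∑ k ∈ Finset.range j, 1 / ((k : ℝ) + 1) + D * ∑ k ∈ Finset.range j, ω k := by
    intro j
    induction j with
    | zero => simp
    | succ j ih =>
      intro hj
      have hj1 : (0 : ℝ) < (j : ℝ) + 1 := by positivity
      have h1 := mul_le_mul_of_nonneg_left (hstep j (by omega)) hj1.le
      have h2 : ((j : ℝ) + 1) * ((1 - 1 / ((j : ℝ) + 1) + C / ((j : ℝ) + 1) ^ 2) * e n j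
          + D / ((j : ℝ) + 1) ^ 2 + D * ω j / ((j : ℝ) + 1))
          = j * e n j + (C * e n j + D) * (1 / ((j : ℝ) + 1)) + D * ω j := by
        field_simp
        ring
      have h3 : (C * e n j + D) * (1 / ((j : ℝ) + 1)) ≤ (C * R + D) * (1 / ((j : ℝ) + 1)) := by
        have := heR n j (by omega)
        gcongr
      rw [Finset.sum_range_succ, Finset.sum_range_succ]
      push_cast
      linarith [ih (by omega)]
  have h1 := htel n le_rfl
  have h2 := hn₁ n hnn₁
  rw [Real.dist_eq, sub_zero] at h2
  have h3 := (le_abs_self _).trans_lt h2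
  rw [Real.dist_eq, sub_zero, abs_of_nonneg (he n n)]
  have h4 : D * ∑ k ∈ Finset.range n, ω k ≤ ε / 2 * n := by
    calc D * ∑ k ∈ Finset.range n, ω k ≤ D * (ε / (2 * (D + 1)) * n) := by gcongr
      _ = D / (D + 1) * (ε / 2 * n) := by field_simp
      _ ≤ 1 * (ε / 2 * n) := by
          gcongr
          rw [div_le_one (by positivity)]
          linarith
      _ = ε / 2 * n := one_mul _
  have h5 : (C * R + D) * ∑ k ∈ Finset.range n, 1 / ((k : ℝ) + 1) < ε / 2 * n := by
    have : (C * R + D) * ∑ k ∈ Finset.range n, 1 / ((k : ℝ) + 1)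
        = (C * R + D) * ((n : ℝ)⁻¹ * ∑ k ∈ Finset.range n, 1 / ((k : ℝ) + 1)) * n := by
      field_simp
    rw [this]
    gcongr
  have h6 : (n : ℝ) * e n n < n * ε := by linarith
  exact lt_of_mul_lt_mul_left h6 hnR.le

/-! ### The scalar equation -/

/-- The moment `∫₀ᵗ sᵐ f(s) ds`. -/
noncomputable def moment (m : ℕ) (f : ℝ → ℝ) (t : ℝ) : ℝ := ∫ s in 0..t, s ^ m * f s

lemma RiemannIntegrableOn.intervalIntegrable_pow_mul {T : ℝ} {hT : 0 < T} {f : ℝ → ℝ}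
    (hf : RiemannIntegrableOn f 0 T hT) (m : ℕ) :
    IntervalIntegrable (fun s => s ^ m * f s) volume 0 T := by
  obtain ⟨M, -, hM⟩ := hf.exists_bound
  have hfi : IntervalIntegrable f volume 0 T := by
    rw [intervalIntegrable_iff_integrableOn_Ico_of_le hT.le]
    refine Integrable.of_bound hf.aestronglyMeasurable M ?_
    filter_upwards [ae_restrict_mem measurableSet_Ico] with t ht
    exact hM t (Ico_subset_Icc_self ht)
  exact hfi.continuousOn_mul (by fun_prop)

lemma LipschitzWith.comp_absolutelyContinuousOnInterval {X Y : Type*} [PseudoMetricSpace X]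
    [PseudoMetricSpace Y] {K : NNReal} {g : X → Y} (hg : LipschitzWith K g) {c : ℝ → X} {a b : ℝ}
    (hc : AbsolutelyContinuousOnInterval c a b) :
    AbsolutelyContinuousOnInterval (fun t => g (c t)) a b := by
  refine squeeze_zero (fun E => Finset.sum_nonneg fun i _ => dist_nonneg) (fun E => ?_)
    (by simpa using Tendsto.const_mul (K : ℝ) hc)
  rw [Finset.mul_sum]
  exact Finset.sum_le_sum fun i _ => hg.dist_le_mul _ _

lemma AbsolutelyContinuousOnInterval.congr_of_eqOn {X : Type*} [PseudoMetricSpace X]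
    {c d : ℝ → X} {a b : ℝ} (hc : AbsolutelyContinuousOnInterval c a b)
    (h : EqOn c d (uIcc a b)) : AbsolutelyContinuousOnInterval d a b := by
  refine Tendsto.congr' ?_ hc
  refine mem_of_superset (mem_inf_of_right (mem_principal_self _)) fun E hE => ?_
  refine Finset.sum_congr rfl fun i hi => ?_
  rw [h (hE.1 i hi).1, h (hE.1 i hi).2]

lemma absolutelyContinuousOnInterval_pi {ι : Type*} [Fintype ι] {c : ℝ → ι → ℝ} {a b : ℝ}
    (hc : ∀ i, AbsolutelyContinuousOnInterval (fun t => c t i) a b) :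
    AbsolutelyContinuousOnInterval c a b := by
  refine squeeze_zero (fun E => Finset.sum_nonneg fun i _ => dist_nonneg) (fun E => ?_)
    (by simpa using tendsto_finsetSum Finset.univ fun i _ => hc i)
  rw [Finset.sum_comm]
  refine Finset.sum_le_sum fun j _ => ?_
  rw [dist_pi_le_iff (Finset.sum_nonneg fun i _ => dist_nonneg)]
  exact fun i => Finset.single_le_sum
    (f := fun i => dist (c (E.2 j).1 i) (c (E.2 j).2 i)) (fun _ _ => dist_nonneg)
    (Finset.mem_univ i)

lemma tendsto_moment {m : ℕ} {f : ℝ → ℝ} {T : ℝ} (hT : 0 < T)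
    (hf : IntervalIntegrable (fun s => s ^ m * f s) volume 0 T) :
    Tendsto (moment m f) (𝓝[>] 0) (𝓝 0) := by
  have h := (hf.absolutelyContinuousOnInterval_intervalIntegral
    (left_mem_uIcc)).continuousOn 0 left_mem_uIcc
  rw [uIcc_of_le hT.le] at h
  have h' := h.tendsto
  rw [intervalIntegral.integral_same] at h'
  refine h'.mono_left ?_
  rw [nhdsWithin_le_iff]
  exact mem_of_superset (Ioo_mem_nhdsGT hT) Ioo_subset_Icc_self

/-- In the variable `t^{m+1} y` the scalar equation `y' = -((m+1)/t) y + (b/t) f` reads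
`(t^{m+1} y)' = b tᵐ f`, and a bounded solution starts at zero in this variable. -/
lemma pow_mul_eq_moment_of_hasDerivAt {m : ℕ} {f y : ℝ → ℝ} {T b Y : ℝ} (hT : 0 < T)
    (hf : IntervalIntegrable (fun s => s ^ m * f s) volume 0 T)
    (hY : ∀ t ∈ Icc 0 T, |y t| ≤ Y)
    (hac : ∀ ε ∈ Ioo 0 T, AbsolutelyContinuousOnInterval y ε T)
    (hode : ∀ᵐ t ∂(volume.restrict (Ioc 0 T)),
      HasDerivAt y (-(1 / t * (((m : ℝ) + 1) * y t)) + 1 / t * (f t * b)) t) :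
    ∀ t ∈ Icc 0 T, t ^ (m + 1) * y t = b * moment m f t := by
  set g : ℝ → ℝ := fun t => t ^ (m + 1) * y t - b * moment m f t with hg
  have hgac : ∀ ε ∈ Ioo 0 T, AbsolutelyContinuousOnInterval g ε T := by
    intro ε hε
    have h1 : AbsolutelyContinuousOnInterval (fun t : ℝ => t ^ (m + 1)) ε T :=
      ContDiffOn.absolutelyContinuousOnInterval (by fun_prop)
    have h2 : AbsolutelyContinuousOnInterval (moment m f) ε T :=
      (hf.absolutelyContinuousOnInterval_intervalIntegral left_mem_uIcc).mono
        (by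
          rw [uIcc_of_le hε.2.le, uIcc_of_le hT.le]
          exact Icc_subset_Icc_left hε.1.le)
    exact (h1.mul (hac ε hε)).sub (h2.const_mul b)
  have hgd : ∀ᵐ t, t ∈ Ioc 0 T → HasDerivAt g 0 t := by
    rw [ae_restrict_iff' measurableSet_Ioc] at hode
    filter_upwards [hode, hf.ae_hasDerivAt_integral] with t h1 h2 ht
    rw [uIcc_of_le hT.le] at h2
    have h3 := h2 (Ioc_subset_Icc_self ht) 0 ⟨le_rfl, hT.le⟩
    have h4 := ((hasDerivAt_pow (m + 1) t).mul (h1 ht)).sub (h3.const_mul b)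
    refine h4.congr_deriv ?_
    have := ht.1.ne'
    rw [pow_succ]
    push_cast
    field_simp
    simp
  have hconst : ∀ t ∈ Ioc 0 T, g t = g T := by
    intro t ht
    rcases ht.2.eq_or_lt with h | h
    · rw [h]
    obtain ⟨K, hK⟩ := (hgac t ⟨ht.1, h⟩).const_of_ae_hasDerivAt_zero (by
      filter_upwards [hgd] with s hs hs'
      rw [uIcc_of_le ht.2] at hs'
      exact hs ⟨ht.1.trans_le hs'.1, hs'.2⟩)
    rw [hK t left_mem_uIcc, hK T right_mem_uIcc]
  have hlim : Tendsto g (𝓝[>] 0) (𝓝 0) := by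
    have h1 : Tendsto (fun t => t ^ (m + 1) * y t) (𝓝[>] 0) (𝓝 0) := by
      have h2 : Tendsto (fun t : ℝ => |t| ^ (m + 1) * Y) (𝓝[>] 0) (𝓝 0) := by
        have : Continuous fun t : ℝ => |t| ^ (m + 1) * Y := by fun_prop
        simpa using (this.tendsto 0).mono_left (nhdsWithin_le_nhds (s := Ioi 0))
      refine squeeze_zero_norm' ?_ h2
      filter_upwards [Ioo_mem_nhdsGT hT] with t ht
      rw [norm_mul, norm_pow, Real.norm_eq_abs, Real.norm_eq_abs]
      exact mul_le_mul_of_nonneg_left (hY t (Ioo_subset_Icc_self ht)) (by positivity)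
    simpa using h1.sub ((tendsto_moment hT hf).const_mul b)
  have hgT : g T = 0 := by
    refine tendsto_nhds_unique ((tendsto_congr' ?_).1 hlim) tendsto_const_nhds |>.symm
    filter_upwards [Ioo_mem_nhdsGT hT] with t ht
    exact hconst t (Ioo_subset_Ioc_self ht)
  intro t ht
  rcases ht.1.eq_or_lt with h | h
  · simp [← h, moment]
  · have := hconst t ⟨h, ht.2⟩
    rw [hgT] at this
    exact sub_eq_zero.1 this

/-- The bounded solution of the scalar equation `y' = -((m+1)/t) y + (b/t) f` on `(0, T]`. -/
lemma hasDerivAt_moment_div {m : ℕ} {f : ℝ → ℝ} {T b : ℝ} (hT : 0 < T)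
    (hf : IntervalIntegrable (fun s => s ^ m * f s) volume 0 T) :
    ∀ᵐ t ∂(volume.restrict (Ioc 0 T)),
      HasDerivAt (fun t => b * (moment m f t / t ^ (m + 1)))
        (-(1 / t * (((m : ℝ) + 1) * (b * (moment m f t / t ^ (m + 1))))) + 1 / t * (f t * b)) t := by
  rw [ae_restrict_iff' measurableSet_Ioc]
  filter_upwards [hf.ae_hasDerivAt_integral] with t h2 ht
  rw [uIcc_of_le hT.le] at h2
  have h3 : HasDerivAt (moment m f) (t ^ m * f t) t :=
    h2 (Ioc_subset_Icc_self ht) 0 ⟨le_rfl, hT.le⟩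
  have h0 := ht.1.ne'
  have h4 := (h3.div (hasDerivAt_pow (m + 1) t) (pow_ne_zero _ h0)).const_mul b
  refine h4.congr_deriv ?_
  push_cast
  field_simp
  ring

lemma absolutelyContinuousOnInterval_moment_div {m : ℕ} {f : ℝ → ℝ} {T b ε : ℝ}
    (hε : ε ∈ Ioo 0 T) (hf : IntervalIntegrable (fun s => s ^ m * f s) volume 0 T) :
    AbsolutelyContinuousOnInterval (fun t => b * (moment m f t / t ^ (m + 1))) ε T := by
  have hT : 0 < T := hε.1.trans hε.2
  have h1 : AbsolutelyContinuousOnInterval (fun t : ℝ => (t ^ (m + 1))⁻¹) ε T := by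
    refine ContDiffOn.absolutelyContinuousOnInterval (ContDiffOn.inv (by fun_prop) ?_)
    intro t ht
    rw [uIcc_of_le hε.2.le] at ht
    exact pow_ne_zero _ (hε.1.trans_le ht.1).ne'
  have h2 : AbsolutelyContinuousOnInterval (moment m f) ε T :=
    (hf.absolutelyContinuousOnInterval_intervalIntegral left_mem_uIcc).mono
      (by
        rw [uIcc_of_le hε.2.le, uIcc_of_le hT.le]
        exact Icc_subset_Icc_left hε.1.le)
  exact (h2.mul h1).const_mul b

/-- The moment over `[u, v]` of a function within `ω` of `κ` there. -/
lemma abs_integral_pow_mul_sub_le {m : ℕ} {f : ℝ → ℝ} {u v κ ω : ℝ} (hu : 0 ≤ u) (huv : u ≤ v)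
    (hf : IntervalIntegrable (fun s => s ^ m * f s) volume u v)
    (hω : ∀ s ∈ Icc u v, |f s - κ| ≤ ω) :
    |(∫ s in u..v, s ^ m * f s) - κ * ((v ^ (m + 1) - u ^ (m + 1)) / (m + 1))|
      ≤ ω * ((v ^ (m + 1) - u ^ (m + 1)) / (m + 1)) := by
  have hpow : ∫ s in u..v, s ^ m = (v ^ (m + 1) - u ^ (m + 1)) / (m + 1) := integral_pow m
  have hi : IntervalIntegrable (fun s : ℝ => s ^ m) volume u v :=
    (continuous_pow m).intervalIntegrable _ _
  rw [← hpow, ← intervalIntegral.integral_const_mul, ← intervalIntegral.integral_const_mul,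
    ← intervalIntegral.integral_sub hf (hi.const_mul κ), ← Real.norm_eq_abs]
  refine intervalIntegral.norm_integral_le_of_norm_le huv ?_ (hi.const_mul ω)
  refine Eventually.of_forall fun s hs => ?_
  have hs0 : 0 ≤ s := hu.trans hs.1.le
  rw [show s ^ m * f s - κ * s ^ m = s ^ m * (f s - κ) by ring, norm_mul, mul_comm ω,
    Real.norm_of_nonneg (pow_nonneg hs0 m)]
  exact mul_le_mul_of_nonneg_left (hω s (Ioc_subset_Icc_self hs)) (pow_nonneg hs0 m)

lemma abs_moment_div_le {m : ℕ} {f : ℝ → ℝ} {T M t : ℝ}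
    (hf : IntervalIntegrable (fun s => s ^ m * f s) volume 0 T)
    (hM : ∀ t ∈ Icc 0 T, |f t| ≤ M) (ht : t ∈ Ioc 0 T) :
    |moment m f t / t ^ (m + 1)| ≤ M := by
  have hM0 : 0 ≤ M := (abs_nonneg _).trans (hM t (Ioc_subset_Icc_self ht))
  have htp : 0 < t ^ (m + 1) := pow_pos ht.1 _
  have h := abs_integral_pow_mul_sub_le (κ := 0) le_rfl ht.1.le
    (hf.mono_set (by
      rw [uIcc_of_le ht.1.le, uIcc_of_le (ht.1.le.trans ht.2)]
      exact Icc_subset_Icc_right ht.2))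
    (fun s hs => by simpa using hM s ⟨hs.1, hs.2.trans ht.2⟩)
  rw [zero_mul, sub_zero, zero_pow (by omega), sub_zero] at h
  rw [abs_div, abs_of_pos htp, div_le_iff₀ htp]
  refine h.trans (mul_le_mul_of_nonneg_left (div_le_self htp.le ?_) hM0)
  linarith [(Nat.cast_nonneg m : (0 : ℝ) ≤ m)]

/-! ### Convergence -/

/-- The exact solution on one cell of the grid: its value is multiplied by
`ρ = (k/(k+1))^{m+1}`, and the input enters with total weight `r = (1 - ρ)/(m+1)`, up to the
oscillation `ω` of `f` on the cell. -/
lemma abs_solution_step_sub_le {m k : ℕ} {f y : ℝ → ℝ} {h T b ω : ℝ} (hh : 0 < h)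
    (hkT : ((k : ℝ) + 1) * h ≤ T)
    (hf : IntervalIntegrable (fun s => s ^ m * f s) volume 0 T)
    (hy : ∀ t ∈ Icc 0 T, t ^ (m + 1) * y t = b * moment m f t)
    (hω : ∀ s ∈ Icc (k * h) ((k + 1) * h), |f s - f (k * h)| ≤ ω) :
    |y ((k + 1) * h) - ((k : ℝ) / (k + 1)) ^ (m + 1) * y (k * h)
      - b * (((m : ℝ) + 1)⁻¹ * (1 - ((k : ℝ) / (k + 1)) ^ (m + 1)) * f (k * h))|
      ≤ |b| * (((m : ℝ) + 1)⁻¹ * (1 - ((k : ℝ) / (k + 1)) ^ (m + 1)) * ω) := by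
  have hu0 : 0 ≤ (k : ℝ) * h := by positivity
  have hv0 : 0 < ((k : ℝ) + 1) * h := by positivity
  have huv : (k : ℝ) * h ≤ (k + 1) * h := by nlinarith
  have hm : (0 : ℝ) < m + 1 := by positivity
  have hk1 : (0 : ℝ) < k + 1 := by positivity
  have hi1 : IntervalIntegrable (fun s => s ^ m * f s) volume 0 (k * h) := hf.mono_set (by
    rw [uIcc_of_le hu0, uIcc_of_le (hv0.le.trans hkT)]
    exact Icc_subset_Icc_right (huv.trans hkT))
  have hi2 : IntervalIntegrable (fun s => s ^ m * f s) volume (k * h) ((k + 1) * h) :=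
    hf.mono_set (by
      rw [uIcc_of_le huv, uIcc_of_le (hv0.le.trans hkT)]
      exact Icc_subset_Icc hu0 hkT)
  have hyu := hy (k * h) ⟨hu0, huv.trans hkT⟩
  have hyv := hy ((k + 1) * h) ⟨hv0.le, hkT⟩
  have hadd : moment m f ((k + 1) * h) = moment m f (k * h)
      + ∫ s in (k * h)..((k + 1) * h), s ^ m * f s :=
    (intervalIntegral.integral_add_adjacent_intervals hi1 hi2).symm
  rw [hadd, mul_add, ← hyu] at hyv
  have hest := abs_integral_pow_mul_sub_le (κ := f (k * h)) hu0 huv hi2 hω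
  set I := ∫ s in (k * h)..((k + 1) * h), s ^ m * f s with hI
  set V := ((((k : ℝ) + 1) * h) ^ (m + 1)) with hV
  have hVp : 0 < V := pow_pos hv0 _
  have hρ : ((k : ℝ) * h) ^ (m + 1) = ((k : ℝ) / (k + 1)) ^ (m + 1) * V := by
    rw [hV, ← mul_pow]
    congr 1
    field_simp
  set ρ := ((k : ℝ) / (k + 1)) ^ (m + 1) with hρd
  rw [hρ] at hyv hest
  have e1 : (V - ρ * V) / ((m : ℝ) + 1) = V * (((m : ℝ) + 1)⁻¹ * (1 - ρ)) := by
    field_simp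
  rw [e1] at hest
  have e2 : y ((k + 1) * h) - ρ * y (k * h) - b * (((m : ℝ) + 1)⁻¹ * (1 - ρ) * f (k * h))
      = b * ((I - f (k * h) * (V * (((m : ℝ) + 1)⁻¹ * (1 - ρ)))) / V) := by
    have : y ((k + 1) * h) = (ρ * V * y (k * h) + b * I) / V := by
      rw [eq_div_iff hVp.ne', ← hyv, mul_comm]
    rw [this]
    field_simp
    ring
  rw [e2, abs_mul]
  refine mul_le_mul_of_nonneg_left ?_ (abs_nonneg b)
  rw [abs_div, abs_of_pos hVp, div_le_iff₀ hVp]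
  exact hest.trans_eq (by ring)

/-- The recursion for the error of one step, along an eigenvector for the eigenvalue `m + 1`. -/
lemma abs_error_step_le (s : LegSScheme) {m k : ℕ} {f y : ℝ → ℝ} {h T b ω Y M z : ℝ} (hh : 0 < h)
    (hkT : ((k : ℝ) + 1) * h ≤ T)
    (hf : IntervalIntegrable (fun s => s ^ m * f s) volume 0 T)
    (hM : ∀ t ∈ Icc 0 T, |f t| ≤ M) (hY : ∀ t ∈ Icc 0 T, |y t| ≤ Y)
    (hy : ∀ t ∈ Icc 0 T, t ^ (m + 1) * y t = b * moment m f t)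
    (hω : ∀ s ∈ Icc (k * h) ((k + 1) * h), |f s - f (k * h)| ≤ ω) :
    |legSMult s m k * z
        + (legSWeightLeft s m k * f (k * h) + legSWeightRight s m k * f ((k + 1) * h)) * b
        - y ((k + 1) * h)|
      ≤ (1 - 1 / ((k : ℝ) + 1) + 3 * ((m : ℝ) + 1) ^ 2 / ((k : ℝ) + 1) ^ 2) * |z - y (k * h)|
        + (3 * ((m : ℝ) + 1) ^ 2 * Y + 3 * ((m : ℝ) + 1) * |b| * M) / ((k : ℝ) + 1) ^ 2
        + 2 * |b| * ω / ((k : ℝ) + 1) := by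
  have hu0 : 0 ≤ (k : ℝ) * h := by positivity
  have huv : (k : ℝ) * h ≤ (k + 1) * h := by nlinarith
  have hk1 : (0 : ℝ) < k + 1 := by positivity
  have hm : (0 : ℝ) < m + 1 := by positivity
  have hstep := abs_solution_step_sub_le hh hkT hf hy hω
  have hmult := abs_legSMult_sub_le s m k
  have hweight := abs_legSWeight_sub_le s m k
  have hright := abs_legSWeightRight_le s m k
  have hpow := abs_natCast_div_pow_sub_le m k
  have hpw := abs_weight_natCast_div_pow_sub_le m k
  have hfv := hω ((k + 1) * h) ⟨huv, le_rfl⟩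
  have hfu := hM (k * h) ⟨hu0, huv.trans hkT⟩
  have hyu := hY (k * h) ⟨hu0, huv.trans hkT⟩
  have hω0 : 0 ≤ ω := (abs_nonneg _).trans hfv
  have hx1 : (k : ℝ) / (k + 1) = 1 - 1 / (k + 1) := by field_simp; ring
  have hx0 : (0 : ℝ) ≤ k / (k + 1) := by positivity
  have hρ0 : 0 ≤ ((k : ℝ) / (k + 1)) ^ (m + 1) := pow_nonneg hx0 _
  have hρ1 : ((k : ℝ) / (k + 1)) ^ (m + 1) ≤ 1 - 1 / (k + 1) := by
    rw [← hx1]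
    exact pow_le_of_le_one hx0 (by rw [hx1]; linarith [one_div_pos.2 hk1]) (by omega)
  have hr1 : ((m : ℝ) + 1)⁻¹ * (1 - ((k : ℝ) / (k + 1)) ^ (m + 1)) ≤ 1 / (k + 1) := by
    have h := one_add_mul_le_pow (a := -(1 / ((k : ℝ) + 1)))
      (by rw [neg_le_neg_iff, div_le_iff₀ hk1]; linarith [(Nat.cast_nonneg k : (0 : ℝ) ≤ k)])
      (m + 1)
    rw [← sub_eq_add_neg, ← hx1] at h
    push_cast at h
    rw [inv_mul_le_iff₀ hm]
    linarith
  set ρ := ((k : ℝ) / (k + 1)) ^ (m + 1)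
  set r := ((m : ℝ) + 1)⁻¹ * (1 - ρ)
  set α := legSMult s m k
  set p := legSWeightLeft s m k
  set q := legSWeightRight s m k
  set u := f (k * h)
  set v := f ((k + 1) * h)
  set yu := y (k * h)
  set yv := y ((k + 1) * h)
  have hαρ : |α - ρ| ≤ 3 * ((m : ℝ) + 1) ^ 2 / ((k : ℝ) + 1) ^ 2 := by
    have h := abs_sub_le α (1 - ((m : ℝ) + 1) / (k + 1)) ρ
    rw [abs_sub_comm (1 - ((m : ℝ) + 1) / (k + 1)) ρ] at h
    refine h.trans ((add_le_add hmult hpow).trans_eq ?_)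
    ring
  have hα : |α| ≤ 1 - 1 / ((k : ℝ) + 1) + 3 * ((m : ℝ) + 1) ^ 2 / ((k : ℝ) + 1) ^ 2 := by
    have h := abs_add_le (α - ρ) ρ
    rw [sub_add_cancel, abs_of_nonneg hρ0] at h
    linarith
  have hpqr : |p + q - r| ≤ 3 * ((m : ℝ) + 1) / ((k : ℝ) + 1) ^ 2 := by
    have h := abs_sub_le (p + q) (1 / ((k : ℝ) + 1)) r
    rw [abs_sub_comm (1 / ((k : ℝ) + 1)) r] at h
    refine h.trans ((add_le_add hweight hpw).trans_eq ?_)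
    ring
  -- stability, consistency of the factor, consistency of the weights, and twice the oscillation
  have hdecomp : α * z + (p * u + q * v) * b - yv
      = α * (z - yu) + (α - ρ) * yu + b * ((p + q - r) * u) + b * (q * (v - u))
        - (yv - ρ * yu - b * (r * u)) := by ring
  have t1 : |α * (z - yu)| ≤
      (1 - 1 / ((k : ℝ) + 1) + 3 * ((m : ℝ) + 1) ^ 2 / ((k : ℝ) + 1) ^ 2) * |z - yu| := by
    rw [abs_mul]
    gcongr
  have t2 : |(α - ρ) * yu| ≤ 3 * ((m : ℝ) + 1) ^ 2 / ((k : ℝ) + 1) ^ 2 * Y := by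
    rw [abs_mul]
    gcongr
  have t3 : |b * ((p + q - r) * u)| ≤ |b| * (3 * ((m : ℝ) + 1) / ((k : ℝ) + 1) ^ 2 * M) := by
    rw [abs_mul, abs_mul]
    gcongr
  have t4 : |b * (q * (v - u))| ≤ |b| * (1 / ((k : ℝ) + 1) * ω) := by
    rw [abs_mul, abs_mul]
    gcongr
  have t5 : |yv - ρ * yu - b * (r * u)| ≤ |b| * (1 / ((k : ℝ) + 1) * ω) :=
    hstep.trans (by gcongr)
  rw [hdecomp]
  have a1 := abs_sub (α * (z - yu) + (α - ρ) * yu + b * ((p + q - r) * u) + b * (q * (v - u)))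
    (yv - ρ * yu - b * (r * u))
  have a2 := abs_add_le (α * (z - yu) + (α - ρ) * yu + b * ((p + q - r) * u)) (b * (q * (v - u)))
  have a3 := abs_add_le (α * (z - yu) + (α - ρ) * yu) (b * ((p + q - r) * u))
  have a4 := abs_add_le (α * (z - yu)) ((α - ρ) * yu)
  have e : (3 * ((m : ℝ) + 1) ^ 2 * Y + 3 * ((m : ℝ) + 1) * |b| * M) / ((k : ℝ) + 1) ^ 2
        + 2 * |b| * ω / ((k : ℝ) + 1)
      = 3 * ((m : ℝ) + 1) ^ 2 / ((k : ℝ) + 1) ^ 2 * Y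
        + |b| * (3 * ((m : ℝ) + 1) / ((k : ℝ) + 1) ^ 2 * M)
        + |b| * (1 / ((k : ℝ) + 1) * ω) + |b| * (1 / ((k : ℝ) + 1) * ω) := by ring
  linarith

/-- Convergence of every method along one eigenvector. The initial value `z₀` is arbitrary: its
contribution decays with the number of steps. -/
lemma tendsto_abs_scalar_error (s : LegSScheme) {T : ℝ} {hT : 0 < T} {m : ℕ} {f y : ℝ → ℝ}
    {b Y z₀ : ℝ} {z : ℕ → ℕ → ℝ} (hf : RiemannIntegrableOn f 0 T hT)
    (hY : ∀ t ∈ Icc 0 T, |y t| ≤ Y)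
    (hy : ∀ t ∈ Icc 0 T, t ^ (m + 1) * y t = b * moment m f t)
    (hz0 : ∀ n, z n 0 = z₀)
    (hz : ∀ n k, z n (k + 1) = legSMult s m k * z n k + (legSWeightLeft s m k * f (k * (T / n))
      + legSWeightRight s m k * f ((k + 1) * (T / n))) * b) :
    Tendsto (fun n : ℕ => |z n n - y (n * (T / n))|) atTop (𝓝 0) := by
  obtain ⟨M, hM0, hM⟩ := hf.exists_bound
  have hfi := hf.intervalIntegrable_pow_mul m
  have hY0 : 0 ≤ Y := (abs_nonneg _).trans (hY 0 ⟨le_rfl, hT.le⟩)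
  have hm1 : (1 : ℝ) ≤ (m : ℝ) + 1 := by linarith [(Nat.cast_nonneg m : (0 : ℝ) ≤ m)]
  have hcell : ∀ n k : ℕ, k < n → 0 < T / n ∧ ((k : ℝ) + 1) * (T / n) ≤ T := by
    intro n k hk
    have hn : (0 : ℝ) < n := by exact_mod_cast (Nat.zero_le k).trans_lt hk
    have hkn : (k : ℝ) + 1 ≤ n := by exact_mod_cast hk
    refine ⟨by positivity, ?_⟩
    calc ((k : ℝ) + 1) * (T / n) ≤ n * (T / n) := by gcongr
      _ = T := by field_simp
  set D₁ := 3 * ((m : ℝ) + 1) ^ 2 * Y + 3 * ((m : ℝ) + 1) * |b| * M with hD₁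
  have hD₁0 : 0 ≤ D₁ := by positivity
  -- The constant `W` comes from the trivial bound `2M` for the oscillation.
  refine tendsto_zero_of_recursive_bound (e := fun n k => |z n k - y (k * (T / n))|)
    (C := 3 * ((m : ℝ) + 1) ^ 2) (D := D₁ + 2 * |b|) (r := |z₀| + Y)
    (W := D₁ + 2 * |b| * (2 * M)) (by nlinarith) (by positivity) (fun _ _ => abs_nonneg _) ?_ ?_ ?_
  · intro n
    have h0 := hY 0 ⟨le_rfl, hT.le⟩
    have := abs_sub (z₀) (y 0)
    simp only [hz0, Nat.cast_zero, zero_mul]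
    linarith
  · intro n k hk
    obtain ⟨hh, hkT⟩ := hcell n k hk
    have hsub : Icc ((k : ℝ) * (T / n)) ((k + 1) * (T / n)) ⊆ Icc 0 T :=
      Icc_subset_Icc (by positivity) hkT
    have hω : ∀ t ∈ Icc ((k : ℝ) * (T / n)) ((k + 1) * (T / n)),
        |f t - f (k * (T / n))| ≤ 2 * M := by
      intro t ht
      have h1 := hM t (hsub ht)
      have h2 := hM (k * (T / n)) (hsub ⟨le_rfl, by nlinarith⟩)
      have := abs_sub (f t) (f (k * (T / n)))
      linarith
    have h := abs_error_step_le s (z := z n k) hh hkT hfi hM hY hy hω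
    rw [← hz] at h
    push_cast
    refine h.trans ?_
    have h1 : D₁ / ((k : ℝ) + 1) ^ 2 ≤ D₁ / ((k : ℝ) + 1) := by
      apply div_le_div_of_nonneg_left hD₁0 (by positivity)
      nlinarith [(Nat.cast_nonneg k : (0 : ℝ) ≤ k)]
    rw [add_div D₁]
    linarith
  · intro ε hε
    obtain ⟨n₀, -, H⟩ := hf.exists_sum_oscillation_le hε
    refine ⟨n₀, fun n hn => ?_⟩
    obtain ⟨ω, hω, hsum⟩ := H n hn
    refine ⟨ω, fun k hk => ?_, hsum⟩
    obtain ⟨hh, hkT⟩ := hcell n k hk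
    have hleft : (k : ℝ) * (T / n) ∈ Icc ((k : ℝ) * (T / n)) ((k + 1) * (T / n)) :=
      ⟨le_rfl, by nlinarith⟩
    have h := abs_error_step_le s (z := z n k) hh hkT hfi hM hY hy
      (fun t ht => hω k hk t ht _ hleft)
    rw [← hz] at h
    push_cast
    refine h.trans ?_
    have hω0 : 0 ≤ ω k := (abs_nonneg _).trans (hω k hk _ hleft _ hleft)
    have : D₁ ≤ D₁ + 2 * |b| := by linarith [abs_nonneg b]
    have : 2 * |b| ≤ D₁ + 2 * |b| := by linarith
    gcongr

/-- In a basis of left eigenvectors a solution of the LegS problem is given by moments of `f`. -/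
lemma IsLegSSolution.pow_mul_mulVec_eq {N : ℕ} {T : ℝ} {hT : 0 < T} {f : ℝ → ℝ}
    {c : ℝ → Fin N → ℝ} {Q : Matrix (Fin N) (Fin N) ℝ} (hc : IsLegSSolution N T f c)
    (hf : RiemannIntegrableOn f 0 T hT)
    (h : Q * legSA N = Matrix.diagonal (fun i : Fin N => (i : ℝ) + 1) * Q) (i : Fin N) :
    (∃ Y : ℝ, ∀ t ∈ Icc 0 T, |(Q *ᵥ c t) i| ≤ Y) ∧
    ∀ t ∈ Icc 0 T, t ^ ((i : ℕ) + 1) * (Q *ᵥ c t) i = (Q *ᵥ legSB N) i * moment i f t := by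
  set ℓ : (Fin N → ℝ) →L[ℝ] ℝ :=
    (ContinuousLinearMap.proj i).comp (Matrix.mulVecLin Q).toContinuousLinearMap with hℓ
  have hℓQ : ∀ v, ℓ v = (Q *ᵥ v) i := fun v => rfl
  obtain ⟨M, hM⟩ := hc.bounded
  have hY : ∀ t ∈ Icc 0 T, |(Q *ᵥ c t) i| ≤ ‖ℓ‖ * M := fun t ht =>
    (ℓ.le_opNorm (c t)).trans (mul_le_mul_of_nonneg_left (hM t ht) (norm_nonneg _))
  refine ⟨⟨_, hY⟩, pow_mul_eq_moment_of_hasDerivAt hT (hf.intervalIntegrable_pow_mul i) hY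
    (fun ε hε => ℓ.lipschitz.comp_absolutelyContinuousOnInterval (hc.absCont ε hε)) ?_⟩
  filter_upwards [hc.ode] with t ht
  refine (ℓ.hasFDerivAt.comp_hasDerivAt t ht).congr_deriv ?_
  rw [map_add, map_neg, map_smul, map_smul, map_smul, hℓQ, hℓQ,
    mulVec_mulVec_of_mul_eq_diagonal_mul h]
  rfl

lemma IsLegSSolution.eqOn {N : ℕ} {T : ℝ} {hT : 0 < T} {f : ℝ → ℝ}
    {c c' : ℝ → Fin N → ℝ} (hc : IsLegSSolution N T f c) (hc' : IsLegSSolution N T f c')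
    (hf : RiemannIntegrableOn f 0 T hT) : EqOn c' c (Icc 0 T) := by
  obtain ⟨Q, hQ, h⟩ := exists_isUnit_mul_legSA N
  intro t ht
  rcases ht.1.eq_or_lt with h0 | h0
  · rw [← h0, hc.initial, hc'.initial]
  refine Matrix.mulVec_injective_of_isUnit hQ (funext fun i => ?_)
  refine mul_left_cancel₀ (pow_ne_zero ((i : ℕ) + 1) h0.ne') ?_
  rw [(hc.pow_mul_mulVec_eq hf h i).2 t ht, (hc'.pow_mul_mulVec_eq hf h i).2 t ht]

lemma exists_isLegSSolution {N : ℕ} {T : ℝ} {hT : 0 < T} {f : ℝ → ℝ}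
    (hf : RiemannIntegrableOn f 0 T hT) : ∃ c, IsLegSSolution N T f c := by
  obtain ⟨Q, hQ, h⟩ := exists_isUnit_mul_legSA N
  have hQd : IsUnit Q.det := (Matrix.isUnit_iff_isUnit_det _).1 hQ
  obtain ⟨M, hM0, hM⟩ := hf.exists_bound
  set w : ℝ → Fin N → ℝ := fun t i =>
    (Q *ᵥ legSB N) i * (moment i f t / t ^ ((i : ℕ) + 1)) with hw
  set ℓ : (Fin N → ℝ) →L[ℝ] (Fin N → ℝ) := (Matrix.mulVecLin Q⁻¹).toContinuousLinearMap with hℓ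
  have hℓQ : ∀ v, ℓ v = Q⁻¹ *ᵥ v := fun v => rfl
  have hQℓ : ∀ v, Q *ᵥ ℓ v = v := fun v => by
    rw [hℓQ, Matrix.mulVec_mulVec, Matrix.mul_nonsing_inv _ hQd, Matrix.one_mulVec]
  set c : ℝ → Fin N → ℝ := fun t => if t = 0 then f 0 • legSe1 N else ℓ (w t) with hc
  have hcw : ∀ t, 0 < t → c t = ℓ (w t) := fun t ht => if_neg ht.ne'
  refine ⟨c, if_pos rfl, ?_, ?_, ?_⟩
  · have hwb : ∀ t ∈ Ioc 0 T, ‖w t‖ ≤ ‖Q *ᵥ legSB N‖ * M := by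
      intro t ht
      rw [pi_norm_le_iff_of_nonneg (by positivity)]
      intro i
      rw [norm_mul]
      exact mul_le_mul (norm_le_pi_norm _ i)
        (abs_moment_div_le (hf.intervalIntegrable_pow_mul i) hM ht) (norm_nonneg _) (norm_nonneg _)
    refine ⟨max ‖f 0 • legSe1 N‖ (‖ℓ‖ * (‖Q *ᵥ legSB N‖ * M)), fun t ht => ?_⟩
    rcases ht.1.eq_or_lt with h0 | h0
    · rw [hc, ← h0]
      simp only [if_true]
      exact le_max_left _ _
    · rw [hcw t h0]
      exact ((ℓ.le_opNorm _).trans (mul_le_mul_of_nonneg_left (hwb t ⟨h0, ht.2⟩)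
        (norm_nonneg _))).trans (le_max_right _ _)
  · intro ε hε
    have h1 : AbsolutelyContinuousOnInterval (fun t => ℓ (w t)) ε T :=
      ℓ.lipschitz.comp_absolutelyContinuousOnInterval (absolutelyContinuousOnInterval_pi fun i =>
        absolutelyContinuousOnInterval_moment_div hε (hf.intervalIntegrable_pow_mul i))
    refine h1.congr_of_eqOn ?_
    intro t ht
    rw [uIcc_of_le hε.2.le] at ht
    exact (hcw t (hε.1.trans_le ht.1)).symm
  · have hd : ∀ᵐ t ∂(volume.restrict (Ioc 0 T)), ∀ i : Fin N,
        HasDerivAt (fun t => w t i)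
          (-(1 / t * (((i : ℝ) + 1) * w t i)) + 1 / t * (f t * (Q *ᵥ legSB N) i)) t :=
      ae_all_iff.2 fun i => hasDerivAt_moment_div hT (hf.intervalIntegrable_pow_mul i)
    filter_upwards [hd, ae_restrict_mem measurableSet_Ioc] with t ht htm
    have h1 := ℓ.hasFDerivAt.comp_hasDerivAt t (hasDerivAt_pi.2 ht)
    have h2 : c =ᶠ[𝓝 t] ℓ ∘ w := by
      filter_upwards [Ioi_mem_nhds htm.1] with r hr
      exact hcw r hr
    refine (h1.congr_of_eventuallyEq h2).congr_deriv ?_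
    rw [hcw t htm.1]
    refine Matrix.mulVec_injective_of_isUnit hQ ?_
    rw [hQℓ]
    ext i
    rw [Matrix.mulVec_add, Matrix.mulVec_neg, Matrix.mulVec_smul, Matrix.mulVec_smul,
      Matrix.mulVec_smul]
    simp only [Pi.add_apply, Pi.neg_apply, Pi.smul_apply, smul_eq_mul,
      mulVec_mulVec_of_mul_eq_diagonal_mul h, hQℓ]

lemma IsLegSSolution.tendsto_norm_sub {N : ℕ} {T : ℝ} {hT : 0 < T} {f : ℝ → ℝ}
    {c : ℝ → Fin N → ℝ} (hc : IsLegSSolution N T f c) (hf : RiemannIntegrableOn f 0 T hT)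
    (s : LegSScheme) :
    Tendsto
      (fun n : ℕ =>
        ‖WithLp.toLp 2 (legSIterate N s (T / (n : ℝ)) f n - c ((n : ℝ) * (T / (n : ℝ))))‖)
      atTop (𝓝 0) := by
  obtain ⟨Q, hQ, h⟩ := exists_isUnit_mul_legSA N
  have hQd : IsUnit Q.det := (Matrix.isUnit_iff_isUnit_det _).1 hQ
  have hcomp : Tendsto (fun n : ℕ =>
      Q *ᵥ (legSIterate N s (T / (n : ℝ)) f n - c ((n : ℝ) * (T / (n : ℝ))))) atTop (𝓝 0) := by
    rw [tendsto_pi_nhds]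
    intro i
    obtain ⟨⟨Y, hY⟩, hy⟩ := hc.pow_mul_mulVec_eq hf h i
    have := tendsto_abs_scalar_error s (z₀ := (Q *ᵥ (f 0 • legSe1 N)) i)
      (z := fun n k => (Q *ᵥ legSIterate N s (T / (n : ℝ)) f k) i) hf hY hy (fun n => rfl)
      (fun n k => mulVec_legSStep hQ h s k _ _ _ i)
    rw [Pi.zero_apply, tendsto_zero_iff_abs_tendsto_zero]
    simpa only [Function.comp_def, Matrix.mulVec_sub, Pi.sub_apply] using this
  have hcont : Continuous fun v : Fin N → ℝ => ‖WithLp.toLp 2 (Q⁻¹ *ᵥ v)‖ := by fun_prop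
  have := (hcont.tendsto 0).comp hcomp
  simpa only [Function.comp_def, Matrix.mulVec_mulVec, Matrix.nonsing_inv_mul _ hQd,
    Matrix.one_mulVec, Matrix.mulVec_zero, WithLp.toLp_zero, norm_zero] using this

theorem mainTheorem3 (N : ℕ) (hN : 1 ≤ N) (T : ℝ) (hT : 0 < T) (f : ℝ → ℝ)
    (hf : RiemannIntegrableOn f 0 T hT) :
    (∃ c : ℝ → Fin N → ℝ, IsLegSSolution N T f c ∧
      ∀ c' : ℝ → Fin N → ℝ, IsLegSSolution N T f c' → Set.EqOn c' c (Set.Icc 0 T)) ∧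
    ∀ c : ℝ → Fin N → ℝ, IsLegSSolution N T f c → ∀ s : LegSScheme,
      Tendsto
        (fun n : ℕ =>
          ‖WithLp.toLp 2 (legSIterate N s (T / (n : ℝ)) f n - c ((n : ℝ) * (T / (n : ℝ))))‖)
        atTop (𝓝 0) := by
  obtain ⟨c, hc⟩ := exists_isLegSSolution (N := N) hf
  exact ⟨⟨c, hc, fun c' hc' => hc.eqOn hc' hf⟩, fun c hc s => hc.tendsto_norm_sub hf s⟩
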